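/- Let $k$ be a field, let $\overline Q=(\overline Q_0,\overline Q_1,\overline\rho)$ be a bound quiver (finitely many arrows between any two vertices; each relation is a $k$-linear combination of paths of one common length $\ge 2$ with common source and common target), and let $\overline\Lambda=k\overline Q/(\overline\rho)$, graded by path length, with paths from $i$ to $j$ lying in $e_j\overline\Lambda e_i$. Let $n\ge 0$ and let $\tau$ be a permutation of $\overline Q_0$. Assume: (1) $\overline Q$ is a stable $n$-translation quiver with $n$-translation $\tau$: every maximal bound path (a path that is nonzero in $\overline\Lambda$ and becomes zero when extended by any arrow on either side) has length $n+1$ and goes from $\tau i$ to $i$ for some vertex $i$; $\dim_k e_i\overline\Lambda_{n+1}e_{\tau i}=1$ for every $i$; and for all $i,j$ and $t$, every nonzero $u\in e_j\overline\Lambda_t e_{\tau i}$ satisfies $qu\neq 0$ for some path $q$ from $j$ to $i$ of length $n+1-t$, and every nonzero $u\in e_i\overline\Lambda_t e_j$ satisfies $uq\ne 0$ for some path $q$ from $\tau i$ to $j$ of length $n+1-t$ (in particular, $t\le n+1$ in both cases). (2) $\overline\Lambda$ is an $n$-translation algebra: there is $q\in\mathbb N\cup\{\infty\}$ such that $\overline\Lambda$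 is $(n+1,q)$-Koszul, i.e. $\overline\Lambda_t=0$ for $t>n+1$ and for each vertex $i$ there is an exact sequence of graded left $\overline\Lambda$-modules and degree-preserving maps $P_q\to\cdots\to P_1\to P_0\to\overline\Lambda_0e_i\to 0$, infinite to the left if $q=\infty$, with each $P_t$ projective and generated in degree $t$, such that, if $q$ is finite, the kernel of the leftmost map (the map out of $P_q$) is the component of $P_q$ of degree $n+1+q$. (3) $\overline Q$ is acyclic (it has no oriented cycles) and has only finitely many $\tau$-orbits of vertices. Let $Q$ be a complete $\tau$-slice of $\overline Q$: the full subquiver on a set $Q_0\subseteq\overline Q_0$ that meets every $\tau$-orbit in exactly one vertex and is convex (every path of $\overline Q$ with both ends in $Q_0$ has all its vertices in $Q_0$), bound by the set $\rho$ of those relations in $\overline\rho$ whose source and target lie in $Q_0$. Then the $\tau$-slice algebra $\Lambda=kQ/(\rho)$, graded by path length, is Koszul: $\Lambda_0$ is semisimple, and the graded left $\Lambda$-module $\Lambda_0=\Lambda/(\Lambda_1\oplus\Lambda_2\oplus\cdots)$ has a graded projective resolution $\cdots\to P_2\to P_1\to P_0\to\Lambda_0\to 0$ with each $P_t$ generated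 in degree $t$. -/

import Mathlib

universe u v w x

open scoped DirectSum

/-! ## Linear resolutions over graded rings -/

/-- A family of graded left modules `P 0, P 1, P 2, …` over an algebra `R` graded by the family `𝒜`,
such that `P t` is projective and generated by its component of degree `t`, together with a
degree-preserving `R`-linear map `d t : P (t + 1) → P t` for every `t` and a degree-preserving
`R`-linear augmentation `ε : P 0 → S` to a module `S` which is concentrated in degree `0`.
`deg t s` is the homogeneous component of degree `s` of `P t`.  (Since `P t` is generated in
degree `t ≥ 0`, it has no component of negative degree.) -/
structure LinearComplex {k : Type w} [CommRing k] {R : Type x} [Ring R] [Algebra k R]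
    (𝒜 : ℕ → Submodule k R)
    (S : Type x) [AddCommGroup S] [Module R S] where
  P : ℕ → Type x
  [addCommGroup : ∀ t, AddCommGroup (P t)]
  [module : ∀ t, Module R (P t)]
  deg : ∀ t, ℕ → AddSubgroup (P t)
  isInternal : ∀ t, DirectSum.IsInternal (deg t)
  smul_mem : ∀ t a b (r : R) (m : P t), r ∈ 𝒜 a → m ∈ deg t b → r • m ∈ deg t (a + b)
  projective : ∀ t, Module.Projective R (P t)
  generated : ∀ t, Submodule.span R (deg t t : Set (P t)) = ⊤
  d : ∀ t, P (t + 1) →ₗ[R] P t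
  d_mem : ∀ t s (m : P (t + 1)), m ∈ deg (t + 1) s → d t m ∈ deg t s
  ε : P 0 →ₗ[R] S
  ε_eq_zero : ∀ s (m : P 0), 0 < s → m ∈ deg 0 s → ε m = 0

namespace LinearComplex

attribute [instance] LinearComplex.addCommGroup LinearComplex.module

variable {k : Type w} [CommRing k] {R : Type x} [Ring R] [Algebra k R] {𝒜 : ℕ → Submodule k R}
  {S : Type x} [AddCommGroup S] [Module R S]

/-- The kernel of the map leaving `P t`: the augmentation for `t = 0`, and the differential
`P t → P (t - 1)` for `t > 0`. -/
def kerAt (C : LinearComplex 𝒜 S) : ∀ t, Submodule R (C.P t)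
  | 0 => LinearMap.ker C.ε
  | t + 1 => LinearMap.ker (C.d t)

/-- Exactness at `P t` (in the augmented complex). -/
def ExactAt (C : LinearComplex 𝒜 S) (t : ℕ) : Prop :=
  C.kerAt t = LinearMap.range (C.d t)

end LinearComplex

/-- `S` (concentrated in degree `0`) has a linear projective resolution: a graded projective
resolution `⋯ → P 2 → P 1 → P 0 → S → 0` with `P t` generated in degree `t`. -/
def HasLinearResolution {k : Type w} [CommRing k] {R : Type x} [Ring R] [Algebra k R]
    (𝒜 : ℕ → Submodule k R)
    (S : Type x) [AddCommGroup S] [Module R S] : Prop :=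
  ∃ C : LinearComplex 𝒜 S, Function.Surjective C.ε ∧ ∀ t, C.ExactAt t

/-- The condition on a simple module `S` in the definition of a `(p, q)`-Koszul algebra.
For `q = ∞`, `S` has a linear projective resolution.  For finite `q` there is an exact sequence
`P q → ⋯ → P 1 → P 0 → S → 0` with `P t` projective and generated in degree `t`, and the kernel of
the leftmost map is the component of degree `p + q` of `P q`.  (Only the terms `P t` with `t ≤ q`
of the family are used.) -/
def HasAlmostLinearResolution {k : Type w} [CommRing k] {R : Type x} [Ring R] [Algebra k R]
    (𝒜 : ℕ → Submodule k R) (p : ℕ) (q : ℕ∞)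
    (S : Type x) [AddCommGroup S] [Module R S] : Prop :=
  ∃ C : LinearComplex 𝒜 S, Function.Surjective C.ε ∧
    (∀ t : ℕ, (t : ℕ∞) < q → C.ExactAt t) ∧
    (∀ t : ℕ, (t : ℕ∞) = q → ∀ m : C.P t, m ∈ C.kerAt t ↔ m ∈ C.deg t (p + t))

/-- The ideal `A₁ ⊕ A₂ ⊕ ⋯`, as a left ideal. -/
def gradedRad {k : Type w} [CommRing k] {R : Type x} [Ring R] [Algebra k R]
    (𝒜 : ℕ → Submodule k R) : Ideal R :=
  Ideal.span {a | ∃ t, 0 < t ∧ a ∈ 𝒜 t}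

/-- A positively graded `k`-algebra `A = A₀ ⊕ A₁ ⊕ ⋯` is Koszul if `A₀` is semisimple and the graded left
`A`-module `A₀ = A / (A₁ ⊕ A₂ ⊕ ⋯)` has a linear projective resolution. -/
def IsKoszul {k : Type w} [CommRing k] {A : Type x} [Ring A] [Algebra k A]
    (𝒜 : ℕ → Submodule k A) [GradedAlgebra 𝒜] : Prop :=
  IsSemisimpleRing (𝒜 0) ∧ HasLinearResolution 𝒜 (A ⧸ gradedRad 𝒜)

/-! ## Bound quivers and their algebras -/

/-- A bound quiver: a locally finite quiver with a set of relations.  Relations are normalized: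
each one is a linear combination of paths with the same source `i`, the same target `j`, and the
same length, which is at least two. -/
structure BoundQuiver (k : Type w) [Field k] where
  V : Type u
  [quiver : Quiver.{v} V]
  finite_hom : ∀ i j : V, Finite (i ⟶ j)
  rel : ∀ i j : V, Set (Quiver.Path i j →₀ k)
  rel_homogeneous : ∀ i j : V, ∀ r ∈ rel i j, ∃ t, 2 ≤ t ∧ ∀ p ∈ r.support, p.length = t

namespace BoundQuiver

open Quiver

attribute [instance] BoundQuiver.quiver

variable {k : Type w} [Field k] (Q : BoundQuiver.{u, v, w} k)

/-- All paths of the quiver, with source and target. -/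
abbrev Paths : Type max u v := Σ i j : Q.V, Path i j

/-- The underlying vector space of the path algebra `kQ`: the paths are a basis. -/
abbrev PathSpace : Type max u v w := Q.Paths →₀ k

open Classical in
/-- The product `q p` of two paths in the path algebra: first `p`, then `q`, if `p` ends where `q`
starts, and zero otherwise. -/
noncomputable def pathMul (q p : Q.Paths) : Q.PathSpace :=
  if h : q.1 = p.2.1 then Finsupp.single ⟨p.1, q.2.1, p.2.2.comp (q.2.2.cast h rfl)⟩ 1 else 0

/-- The multiplication of the path algebra. -/
noncomputable def mulL : Q.PathSpace →ₗ[k] Q.PathSpace →ₗ[k] Q.PathSpace :=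
  Finsupp.linearCombination k
    (fun q : Q.Paths => Finsupp.linearCombination k (fun p : Q.Paths => Q.pathMul q p))

/-- The element of the path algebra given by a path. -/
noncomputable def ofPath {i j : Q.V} (p : Path i j) : Q.PathSpace :=
  Finsupp.single ⟨i, j, p⟩ 1

/-- The element `q r p` of the path algebra, for a linear combination `r` of paths from `a`
to `b` and paths `p` ending in `a` and `q` starting in `b`. -/
noncomputable def conj {a b i j : Q.V} (p : Path i a) (q : Path b j) :
    (Path a b →₀ k) →ₗ[k] Q.PathSpace :=
  Finsupp.lmapDomain k k (fun m : Path a b => (⟨i, j, p.comp (m.comp q)⟩ : Q.Paths))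

/-- The two-sided ideal `(ρ)` of the path algebra generated by the relations: the span of the
elements `q r p` with `r` a relation and `p`, `q` paths. -/
noncomputable def relIdeal : Submodule k Q.PathSpace :=
  Submodule.span k {y | ∃ (a b i j : Q.V) (p : Path i a) (r : Path a b →₀ k) (q : Path b j),
    r ∈ Q.rel a b ∧ y = Q.conj p q r}

/-- The bound quiver algebra `kQ / (ρ)`. -/
def Alg : Type max u v w := Q.PathSpace ⧸ Q.relIdeal

noncomputable instance : AddCommGroup Q.Alg :=
  inferInstanceAs (AddCommGroup (Q.PathSpace ⧸ Q.relIdeal))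

noncomputable instance : Module k Q.Alg :=
  inferInstanceAs (Module k (Q.PathSpace ⧸ Q.relIdeal))

/-- The quotient map `kQ → kQ / (ρ)`. -/
noncomputable def toAlg : Q.PathSpace →ₗ[k] Q.Alg := Q.relIdeal.mkQ

/-- The image of a path in the bound quiver algebra. -/
noncomputable def cls {i j : Q.V} (p : Path i j) : Q.Alg := Q.toAlg (Q.ofPath p)

variable {Q} in
theorem pathMul_of_comp {a b c : Q.V} (q : Path b c) (p : Path a b) :
    Q.pathMul ⟨b, c, q⟩ ⟨a, b, p⟩ = Q.ofPath (p.comp q) := by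
  simp [pathMul, ofPath]

variable {Q} in
theorem pathMul_of_ne {q p : Q.Paths} (h : q.1 ≠ p.2.1) : Q.pathMul q p = 0 := by
  simp [pathMul, h]

theorem mulL_single (q p : Q.Paths) (a b : k) :
    Q.mulL (Finsupp.single q a) (Finsupp.single p b) = a • b • Q.pathMul q p := by
  simp [mulL]

theorem mulL_ofPath {a b c : Q.V} (q : Path b c) (p : Path a b) :
    Q.mulL (Q.ofPath q) (Q.ofPath p) = Q.ofPath (p.comp q) := by
  rw [ofPath, ofPath, mulL_single, pathMul_of_comp, one_smul, one_smul]

theorem mulL_ofPath_ne {a b c d : Q.V} (q : Path c d) (p : Path a b) (h : c ≠ b) :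
    Q.mulL (Q.ofPath q) (Q.ofPath p) = 0 := by
  rw [ofPath, ofPath, mulL_single, pathMul_of_ne h, smul_zero, smul_zero]

theorem mulL_assoc_ofPath {a b c d e f : Q.V} (z : Path e f) (y : Path c d) (x : Path a b) :
    Q.mulL (Q.mulL (Q.ofPath z) (Q.ofPath y)) (Q.ofPath x) =
      Q.mulL (Q.ofPath z) (Q.mulL (Q.ofPath y) (Q.ofPath x)) := by
  by_cases h1 : e = d
  · subst h1
    by_cases h2 : c = b
    · subst h2
      simp only [mulL_ofPath, Path.comp_assoc]
    · simp only [mulL_ofPath, mulL_ofPath_ne _ _ _ h2, map_zero]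
  · by_cases h2 : c = b
    · subst h2
      simp only [mulL_ofPath, mulL_ofPath_ne _ _ _ h1, map_zero, LinearMap.zero_apply]
    · simp only [mulL_ofPath_ne _ _ _ h1, mulL_ofPath_ne _ _ _ h2, map_zero, LinearMap.zero_apply]

/-- Induction on elements of the path algebra. -/
@[elab_as_elim]
theorem pathSpace_induction {C : Q.PathSpace → Prop} (x : Q.PathSpace) (h0 : C 0)
    (hadd : ∀ x y, C x → C y → C (x + y)) (hsmul : ∀ (a : k) x, C x → C (a • x))
    (hp : ∀ (i j : Q.V) (p : Path i j), C (Q.ofPath p)) : C x := by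
  induction x using Finsupp.induction_linear with
  | zero => exact h0
  | add f g hf hg => exact hadd f g hf hg
  | single s a =>
    obtain ⟨i, j, p⟩ := s
    have h := hsmul a _ (hp i j p)
    rwa [ofPath, Finsupp.smul_single, smul_eq_mul, mul_one] at h

theorem mulL_assoc (z y x : Q.PathSpace) : Q.mulL (Q.mulL z y) x = Q.mulL z (Q.mulL y x) := by
  refine Q.pathSpace_induction z ?_ ?_ ?_ ?_
  · simp
  · intro a b ha hb
    simp [ha, hb]
  · intro a b hb
    simp [hb]
  intro e f z
  refine Q.pathSpace_induction y ?_ ?_ ?_ ?_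
  · simp
  · intro a b ha hb
    simp [ha, hb]
  · intro a b hb
    simp [hb]
  intro c d y
  refine Q.pathSpace_induction x ?_ ?_ ?_ ?_
  · simp
  · intro a b ha hb
    simp [ha, hb]
  · intro a b hb
    simp [hb]
  intro a b x
  exact Q.mulL_assoc_ofPath z y x

theorem conj_single {a b i j : Q.V} (p : Path i a) (q : Path b j) (m : Path a b) (c : k) :
    Q.conj p q (Finsupp.single m c) = c • Q.ofPath (p.comp (m.comp q)) := by
  simp [conj, ofPath]

theorem mulL_conj {a b i j l : Q.V} (p : Path i a) (q : Path b j) (q' : Path j l)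
    (r : Path a b →₀ k) : Q.mulL (Q.ofPath q') (Q.conj p q r) = Q.conj p (q.comp q') r := by
  induction r using Finsupp.induction_linear with
  | zero => simp
  | add f g hf hg => simp [hf, hg]
  | single m c => simp [conj_single, mulL_ofPath]

theorem mulL_conj_ne {a b i j l m : Q.V} (p : Path i a) (q : Path b j) (q' : Path l m)
    (h : l ≠ j) (r : Path a b →₀ k) : Q.mulL (Q.ofPath q') (Q.conj p q r) = 0 := by
  induction r using Finsupp.induction_linear with
  | zero => simp
  | add f g hf hg => simp [hf, hg]
  | single m c => simp [conj_single, mulL_ofPath_ne _ _ _ h]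

theorem conj_mulL {a b i j l : Q.V} (p : Path i a) (q : Path b j) (p' : Path l i)
    (r : Path a b →₀ k) : Q.mulL (Q.conj p q r) (Q.ofPath p') = Q.conj (p'.comp p) q r := by
  induction r using Finsupp.induction_linear with
  | zero => simp
  | add f g hf hg => simp [hf, hg]
  | single m c => simp [conj_single, mulL_ofPath]

theorem conj_mulL_ne {a b i j l m : Q.V} (p : Path i a) (q : Path b j) (p' : Path l m)
    (h : i ≠ m) (r : Path a b →₀ k) : Q.mulL (Q.conj p q r) (Q.ofPath p') = 0 := by
  induction r using Finsupp.induction_linear with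
  | zero => simp
  | add f g hf hg => simp [hf, hg]
  | single m c => simp [conj_single, mulL_ofPath_ne _ _ _ h]

theorem mulL_mem_left (z : Q.PathSpace) {y : Q.PathSpace} (hy : y ∈ Q.relIdeal) :
    Q.mulL z y ∈ Q.relIdeal := by
  refine Q.pathSpace_induction z ?_ ?_ ?_ ?_
  · simp
  · intro a b ha hb
    simpa using add_mem ha hb
  · intro a b hb
    simpa using Submodule.smul_mem _ a hb
  intro l m q'
  induction hy using Submodule.span_induction with
  | zero => simp
  | add a b _ _ ha hb => simpa using add_mem ha hb
  | smul a b _ hb => simpa using Submodule.smul_mem _ a hb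
  | mem y hy =>
    obtain ⟨a, b, i, j, p, r, q, hr, rfl⟩ := hy
    by_cases h : l = j
    · subst h
      rw [mulL_conj]
      exact Submodule.subset_span ⟨a, b, i, m, p, r, _, hr, rfl⟩
    · rw [mulL_conj_ne _ _ _ _ h]
      exact zero_mem _

theorem mulL_mem_right {z : Q.PathSpace} (y : Q.PathSpace) (hz : z ∈ Q.relIdeal) :
    Q.mulL z y ∈ Q.relIdeal := by
  refine Q.pathSpace_induction y ?_ ?_ ?_ ?_
  · simp
  · intro a b ha hb
    simpa using add_mem ha hb
  · intro a b hb
    simpa using Submodule.smul_mem _ a hb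
  intro l m p'
  induction hz using Submodule.span_induction with
  | zero => simp
  | add a b _ _ ha hb => simpa using add_mem ha hb
  | smul a b _ hb => simpa using Submodule.smul_mem _ a hb
  | mem y hy =>
    obtain ⟨a, b, i, j, p, r, q, hr, rfl⟩ := hy
    by_cases h : i = m
    · subst h
      rw [conj_mulL]
      exact Submodule.subset_span ⟨a, b, l, j, _, r, q, hr, rfl⟩
    · rw [conj_mulL_ne _ _ _ _ h]
      exact zero_mem _

theorem toAlg_eq_zero {y : Q.PathSpace} : Q.toAlg y = 0 ↔ y ∈ Q.relIdeal :=
  Submodule.Quotient.mk_eq_zero _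

theorem toAlg_surjective : Function.Surjective Q.toAlg := Submodule.mkQ_surjective _

/-- A linear map out of `kQ` which kills `(ρ)` induces a linear map out of `kQ / (ρ)`. -/
noncomputable def algLift {M : Type*} [AddCommGroup M] [Module k M] (f : Q.PathSpace →ₗ[k] M)
    (h : ∀ y ∈ Q.relIdeal, f y = 0) : Q.Alg →ₗ[k] M :=
  Q.relIdeal.liftQ f h

theorem algLift_toAlg {M : Type*} [AddCommGroup M] [Module k M] (f : Q.PathSpace →ₗ[k] M)
    (h : ∀ y ∈ Q.relIdeal, f y = 0) (y : Q.PathSpace) : Q.algLift f h (Q.toAlg y) = f y := rfl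

/-- The multiplication of `kQ / (ρ)`, as a map in the second variable. -/
noncomputable def algMulAux : Q.Alg →ₗ[k] Q.PathSpace →ₗ[k] Q.Alg :=
  Q.algLift (Q.mulL.flip.compr₂ Q.toAlg) (fun _ hy => LinearMap.ext fun z =>
    Q.toAlg_eq_zero.2 (Q.mulL_mem_left z hy))

theorem algMulAux_toAlg (z y : Q.PathSpace) :
    Q.algMulAux (Q.toAlg y) z = Q.toAlg (Q.mulL z y) := by
  rw [algMulAux, algLift_toAlg, LinearMap.compr₂_apply, LinearMap.flip_apply]

theorem algMulAux_flip_eq_zero (z : Q.PathSpace) (hz : z ∈ Q.relIdeal) :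
    Q.algMulAux.flip z = 0 := by
  refine LinearMap.ext fun y => ?_
  obtain ⟨y, rfl⟩ := Q.toAlg_surjective y
  rw [LinearMap.flip_apply, algMulAux_toAlg, LinearMap.zero_apply, toAlg_eq_zero]
  exact Q.mulL_mem_right y hz

/-- The multiplication of `kQ / (ρ)`, induced by that of `kQ`. -/
noncomputable def algMul : Q.Alg →ₗ[k] Q.Alg →ₗ[k] Q.Alg :=
  Q.algLift Q.algMulAux.flip Q.algMulAux_flip_eq_zero

noncomputable instance : Mul Q.Alg := ⟨fun z y => Q.algMul z y⟩

theorem alg_mul_def (z y : Q.Alg) : z * y = Q.algMul z y := rfl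

theorem toAlg_mul (z y : Q.PathSpace) : Q.toAlg z * Q.toAlg y = Q.toAlg (Q.mulL z y) := by
  change Q.algMul (Q.toAlg z) (Q.toAlg y) = _
  rw [algMul, algLift_toAlg, LinearMap.flip_apply, algMulAux_toAlg]

noncomputable instance : NonUnitalRing Q.Alg :=
  { (inferInstance : AddCommGroup Q.Alg), (inferInstance : Mul Q.Alg) with
    left_distrib := fun a b c => by simp [alg_mul_def]
    right_distrib := fun a b c => by simp [alg_mul_def]
    zero_mul := fun a => by simp [alg_mul_def]
    mul_zero := fun a => by simp [alg_mul_def]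
    mul_assoc := fun a b c => by
      obtain ⟨a, rfl⟩ := Q.toAlg_surjective a
      obtain ⟨b, rfl⟩ := Q.toAlg_surjective b
      obtain ⟨c, rfl⟩ := Q.toAlg_surjective c
      simp only [toAlg_mul, mulL_assoc] }

instance : IsScalarTower k Q.Alg Q.Alg :=
  ⟨fun a b c => by simp [alg_mul_def]⟩

instance : SMulCommClass k Q.Alg Q.Alg :=
  ⟨fun a b c => by simp [alg_mul_def]⟩

theorem cls_mul_cls {a b c : Q.V} (q : Path b c) (p : Path a b) :
    Q.cls q * Q.cls p = Q.cls (p.comp q) := by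
  simp only [cls, toAlg_mul, mulL_ofPath]

theorem cls_mul_cls_ne {a b c d : Q.V} (q : Path c d) (p : Path a b) (h : c ≠ b) :
    Q.cls q * Q.cls p = 0 := by
  simp only [cls, toAlg_mul, mulL_ofPath_ne _ _ _ h, map_zero]

/-- The primitive idempotent `e_i`: the class of the trivial path at `i`. -/
noncomputable def idem (i : Q.V) : Q.Alg := Q.cls (Path.nil : Path i i)

/-- The homogeneous component of degree `t` of `kQ / (ρ)`: the span of the paths of length `t`. -/
noncomputable def degree (t : ℕ) : Submodule k Q.Alg :=
  Submodule.span k {y | ∃ (i j : Q.V) (p : Path i j), p.length = t ∧ y = Q.cls p}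

/-- The space `e_j Λ_t e_i`, for `Λ = kQ / (ρ)`: the span of the paths of length `t` from `i`
to `j`. -/
noncomputable def component (i j : Q.V) (t : ℕ) : Submodule k Q.Alg :=
  Submodule.span k {y | ∃ p : Path i j, p.length = t ∧ y = Q.cls p}

/-- Induction on elements of the bound quiver algebra. -/
@[elab_as_elim]
theorem alg_induction {C : Q.Alg → Prop} (x : Q.Alg) (h0 : C 0)
    (hadd : ∀ x y, C x → C y → C (x + y)) (hsmul : ∀ (a : k) x, C x → C (a • x))
    (hp : ∀ (i j : Q.V) (p : Path i j), C (Q.cls p)) : C x := by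
  obtain ⟨x, rfl⟩ := Q.toAlg_surjective x
  refine Q.pathSpace_induction x ?_ ?_ ?_ hp
  · simpa using h0
  · intro a b ha hb
    simpa using hadd _ _ ha hb
  · intro a b hb
    simpa using hsmul a _ hb

theorem cls_mem_degree {i j : Q.V} (p : Path i j) : Q.cls p ∈ Q.degree p.length :=
  Submodule.subset_span ⟨i, j, p, rfl, rfl⟩

theorem mul_mem_degree {s t : ℕ} {x y : Q.Alg} (hx : x ∈ Q.degree s) (hy : y ∈ Q.degree t) :
    x * y ∈ Q.degree (s + t) := by
  induction hx using Submodule.span_induction with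
  | zero => simp
  | add a b _ _ ha hb => simpa [add_mul] using add_mem ha hb
  | smul a b _ hb => simpa [smul_mul_assoc] using Submodule.smul_mem _ a hb
  | mem x hx =>
    obtain ⟨c, d, q, rfl, rfl⟩ := hx
    induction hy using Submodule.span_induction with
    | zero => simp
    | add a b _ _ ha hb => simpa [mul_add] using add_mem ha hb
    | smul a b _ hb => simpa [mul_smul_comm] using Submodule.smul_mem _ a hb
    | mem y hy =>
      obtain ⟨a, b, p, rfl, rfl⟩ := hy
      by_cases h : c = b
      · subst h
        rw [cls_mul_cls, add_comm, ← Path.length_comp]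
        exact Q.cls_mem_degree _
      · rw [cls_mul_cls_ne _ _ _ h]
        exact zero_mem _

/-- Decomposition of an element of the path algebra by path length, with values in the graded
components of the quotient. -/
noncomputable def decomposeL : Q.PathSpace →ₗ[k] ⨁ t, Q.degree t :=
  Finsupp.linearCombination k (fun p : Q.Paths =>
    DirectSum.lof k ℕ (fun t => Q.degree t) p.2.2.length ⟨Q.cls p.2.2, Q.cls_mem_degree _⟩)

theorem decomposeL_ofPath {i j : Q.V} (p : Path i j) :
    Q.decomposeL (Q.ofPath p) =
      DirectSum.lof k ℕ (fun t => Q.degree t) p.length ⟨Q.cls p, Q.cls_mem_degree _⟩ := by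
  simp [decomposeL, ofPath]

theorem lof_eq {s t : ℕ} (h : s = t) (x : Q.Alg) (hs : x ∈ Q.degree s) (ht : x ∈ Q.degree t) :
    DirectSum.lof k ℕ (fun t => Q.degree t) s ⟨x, hs⟩ =
      DirectSum.lof k ℕ (fun t => Q.degree t) t ⟨x, ht⟩ := by
  subst h
  rfl

theorem decomposeL_eq_of_homogeneous {a b i j : Q.V} (p : Path i a) (q : Path b j)
    (r : Path a b →₀ k) (t : ℕ) (hr : ∀ m ∈ r.support, m.length = t) :
    ∃ h : Q.toAlg (Q.conj p q r) ∈ Q.degree (p.length + (t + q.length)),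
      Q.decomposeL (Q.conj p q r) = DirectSum.lof k ℕ (fun t => Q.degree t) _ ⟨_, h⟩ := by
  have hsum : r = ∑ m ∈ r.support, Finsupp.single m (r m) := (Finsupp.sum_single r).symm
  have hconj : Q.conj p q r =
      ∑ m ∈ r.support, r m • Q.ofPath (p.comp (m.comp q)) := by
    conv_lhs => rw [hsum]
    rw [map_sum]
    exact Finset.sum_congr rfl fun m _ => Q.conj_single p q m _
  have hmem : ∀ m ∈ r.support, Q.cls (p.comp (m.comp q)) ∈
      Q.degree (p.length + (t + q.length)) := by
    intro m hm
    have h := Q.cls_mem_degree (p.comp (m.comp q))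
    rwa [Path.length_comp, Path.length_comp, hr m hm] at h
  have hT : Q.toAlg (Q.conj p q r) = ∑ m ∈ r.support, r m • Q.cls (p.comp (m.comp q)) := by
    rw [hconj, map_sum]
    exact Finset.sum_congr rfl fun m _ => map_smul _ _ _
  have h : Q.toAlg (Q.conj p q r) ∈ Q.degree (p.length + (t + q.length)) := by
    rw [hT]
    exact Submodule.sum_mem _ fun m hm => Submodule.smul_mem _ _ (hmem m hm)
  refine ⟨h, ?_⟩
  have hS : (⟨_, h⟩ : Q.degree (p.length + (t + q.length))) =
      ∑ m ∈ r.support.attach,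
        r m.1 • (⟨Q.cls (p.comp (m.1.comp q)), hmem m.1 m.2⟩ : Q.degree _) := by
    apply Subtype.ext
    simp only [AddSubmonoidClass.coe_finsetSum, SetLike.val_smul]
    rw [hT, ← Finset.sum_attach]
  rw [hS, hconj, map_sum, map_sum, ← Finset.sum_attach]
  refine Finset.sum_congr rfl fun m _ => ?_
  rw [map_smul, map_smul, decomposeL_ofPath]
  congr 1
  refine Q.lof_eq ?_ _ _ _
  rw [Path.length_comp, Path.length_comp, hr m.1 m.2]

/-- Decomposition of an element of `kQ / (ρ)` into homogeneous components. -/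
noncomputable def algDecompose : Q.Alg →ₗ[k] ⨁ t, Q.degree t :=
  Q.algLift Q.decomposeL (by
    change Q.relIdeal ≤ LinearMap.ker Q.decomposeL
    rw [relIdeal, Submodule.span_le]
    rintro y ⟨a, b, i, j, p, r, q, hr, rfl⟩
    obtain ⟨t, -, ht⟩ := Q.rel_homogeneous a b r hr
    obtain ⟨h, h'⟩ := Q.decomposeL_eq_of_homogeneous p q r t ht
    have h0 : Q.toAlg (Q.conj p q r) = 0 :=
      Q.toAlg_eq_zero.2 (Submodule.subset_span ⟨a, b, i, j, p, r, q, hr, rfl⟩)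
    rw [SetLike.mem_coe, LinearMap.mem_ker, h']
    have h1 : (⟨_, h⟩ : Q.degree (p.length + (t + q.length))) = 0 := Subtype.ext h0
    rw [h1, map_zero])

theorem algDecompose_cls {i j : Q.V} (p : Path i j) :
    Q.algDecompose (Q.cls p) =
      DirectSum.lof k ℕ (fun t => Q.degree t) p.length ⟨Q.cls p, Q.cls_mem_degree _⟩ :=
  Q.decomposeL_ofPath p

theorem algDecompose_of_mem {t : ℕ} (x : Q.Alg) (hx : x ∈ Q.degree t) :
    Q.algDecompose x = DirectSum.lof k ℕ (fun t => Q.degree t) t ⟨x, hx⟩ := by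
  induction hx using Submodule.span_induction with
  | zero =>
    rw [map_zero]
    exact (map_zero _).symm
  | add a b ha hb h1 h2 =>
    rw [map_add, h1, h2, ← map_add]
    rfl
  | smul a b hb h1 =>
    rw [map_smul, h1, ← map_smul]
    rfl
  | mem x hx =>
    obtain ⟨i, j, p, rfl, rfl⟩ := hx
    exact Q.algDecompose_cls p

/-- The grading of `kQ / (ρ)` by path length is a direct sum decomposition. -/
noncomputable instance degreeDecomposition : DirectSum.Decomposition Q.degree :=
  DirectSum.Decomposition.ofLinearMap Q.degree Q.algDecompose
    (by
      refine LinearMap.ext fun x => ?_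
      refine Q.alg_induction x ?_ ?_ ?_ ?_
      · simp
      · intro a b ha hb
        simpa using congrArg₂ (· + ·) ha hb
      · intro a b hb
        simpa using congrArg (a • ·) hb
      · intro i j p
        rw [LinearMap.comp_apply, algDecompose_cls, DirectSum.coeLinearMap_lof]
        rfl)
    (by
      refine DirectSum.linearMap_ext k fun t => LinearMap.ext fun x => ?_
      simp only [LinearMap.comp_apply, DirectSum.coeLinearMap_lof, LinearMap.id_apply]
      exact Q.algDecompose_of_mem x.1 x.2)

/-! ### The unital algebra of a bound quiver with finitely many vertices -/

section Finite

variable [Finite Q.V]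

/-- If there are finitely many vertices, then `∑ e_i` is the identity of `kQ / (ρ)`. -/
noncomputable instance : One Q.Alg :=
  ⟨letI := Fintype.ofFinite Q.V; ∑ i, Q.idem i⟩

theorem one_def [Fintype Q.V] : (1 : Q.Alg) = ∑ i, Q.idem i := by
  change (letI := Fintype.ofFinite Q.V; ∑ i, Q.idem i) = _
  convert rfl

theorem one_mul_cls {i j : Q.V} (p : Path i j) : 1 * Q.cls p = Q.cls p := by
  let _ := Fintype.ofFinite Q.V
  rw [one_def, Finset.sum_mul, Finset.sum_eq_single j]
  · rw [idem, cls_mul_cls, Path.comp_nil]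
  · intro l _ hl
    exact Q.cls_mul_cls_ne _ _ hl
  · simp

theorem cls_mul_one {i j : Q.V} (p : Path i j) : Q.cls p * 1 = Q.cls p := by
  let _ := Fintype.ofFinite Q.V
  rw [one_def, Finset.mul_sum, Finset.sum_eq_single i]
  · rw [idem, cls_mul_cls, Path.nil_comp]
  · intro l _ hl
    exact Q.cls_mul_cls_ne _ _ hl.symm
  · simp

noncomputable instance : Ring Q.Alg :=
  { (inferInstance : NonUnitalRing Q.Alg), (inferInstance : One Q.Alg) with
    one_mul := fun a => by
      refine Q.alg_induction a (mul_zero (1 : Q.Alg)) ?_ ?_ fun i j p => Q.one_mul_cls p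
      · intro a b ha hb
        rw [mul_add, ha, hb]
      · intro c b hb
        rw [mul_smul_comm, hb]
    mul_one := fun a => by
      refine Q.alg_induction a (zero_mul (1 : Q.Alg)) ?_ ?_ fun i j p => Q.cls_mul_one p
      · intro a b ha hb
        rw [add_mul, ha, hb]
      · intro c b hb
        rw [smul_mul_assoc, hb] }

noncomputable instance : Algebra k Q.Alg :=
  Algebra.ofModule (fun a b c => smul_mul_assoc a b c) (fun a b c => mul_smul_comm a b c)

theorem one_mem_degree : (1 : Q.Alg) ∈ Q.degree 0 := by
  let _ := Fintype.ofFinite Q.V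
  rw [one_def]
  exact Submodule.sum_mem _ fun i _ => Q.cls_mem_degree (Path.nil : Path i i)

noncomputable instance : GradedAlgebra Q.degree where
  one_mem := Q.one_mem_degree
  mul_mem := fun _ _ _ _ hx hy => Q.mul_mem_degree hx hy
  toDecomposition := Q.degreeDecomposition

end Finite

/-! ### `(p, q)`-Koszul bound quiver algebras

If the quiver has infinitely many vertices, `Λ = kQ / (ρ)` has no identity element.  Left
`Λ`-modules are then the unital left modules over the algebra `k ⊕ Λ` obtained by adjoining an
identity; a left `Λ`-module is projective over `Λ` if and only if it is projective over `k ⊕ Λ`. -/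

/-- The component of degree `t` of `k ⊕ Λ`, where `k` has degree `0`. -/
noncomputable def unitDegree (t : ℕ) : Submodule k (Unitization k Q.Alg) :=
  (Q.degree t).map (Unitization.inrHom k k Q.Alg) ⊔ (if t = 0 then Submodule.span k {1} else ⊥)

/-- The simple left module `Λ₀ e_i = Λ e_i / (Λ₁ ⊕ Λ₂ ⊕ ⋯) e_i` at the vertex `i`, as the quotient
of `k ⊕ Λ` by the left ideal generated by `1 - e_i` and `Λ₁ ⊕ Λ₂ ⊕ ⋯`. -/
abbrev Simple (i : Q.V) : Type max u v w :=
  Unitization k Q.Alg ⧸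
    (Ideal.span {1 - (Q.idem i : Unitization k Q.Alg)} ⊔ gradedRad Q.unitDegree)

/-- The algebra `Λ = kQ / (ρ)` is `(p, q)`-Koszul: `Λ_t = 0` for `t > p`, and for every vertex `i`
the simple module `Λ₀ e_i` has a projective resolution which is linear up to the term `P q`, where
the kernel is concentrated in degree `p + q` (for `q = ∞`, a linear projective resolution). -/
def IsAlmostKoszul (p : ℕ) (q : ℕ∞) : Prop :=
  (∀ t, p < t → Q.degree t = ⊥) ∧
    ∀ i, HasAlmostLinearResolution Q.unitDegree p q (Q.Simple i)

/-! ### Stable `n`-translation quivers and algebras -/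

/-- A bound path is a path with nonzero image in `kQ / (ρ)`; it is maximal if it cannot be extended
by an arrow, on either side, to a longer bound path. -/
def IsMaximalBoundPath {i j : Q.V} (p : Path i j) : Prop :=
  Q.cls p ≠ 0 ∧ (∀ (l : Q.V) (α : j ⟶ l), Q.cls (p.comp α.toPath) = 0) ∧
    (∀ (l : Q.V) (α : l ⟶ i), Q.cls (α.toPath.comp p) = 0)

/-- A stable `n`-translation quiver with `n`-translation `τ`, a permutation of the vertices.
Put `Λ = kQ / (ρ)`.  Every maximal bound path has length `n + 1` and goes from `τ i` to `i` for
some vertex `i`; the space `e_i Λ_{n+1} e_{τ i}` is one-dimensional for every `i`; and the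
multiplication `e_i Λ_{n+1-t} e_j × e_j Λ_t e_{τ i} → e_i Λ_{n+1} e_{τ i}` is nondegenerate on both
sides.  (So `Λ` is a graded self-injective algebra, all of whose indecomposable projective modules
have Loewy length `n + 2`, with Nakayama permutation given by `τ`.) -/
structure IsStableTranslationQuiver (n : ℕ) (τ : Equiv.Perm Q.V) : Prop where
  maximal : ∀ (i j : Q.V) (p : Path i j), Q.IsMaximalBoundPath p → p.length = n + 1 ∧ i = τ j
  finrank_eq_one : ∀ i, Module.finrank k (Q.component (τ i) i (n + 1)) = 1
  nondegenerate_left : ∀ (i j : Q.V) (t : ℕ), ∀ y ∈ Q.component (τ i) j t, y ≠ 0 →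
    ∃ q : Path j i, q.length + t = n + 1 ∧ Q.cls q * y ≠ 0
  nondegenerate_right : ∀ (i j : Q.V) (t : ℕ), ∀ y ∈ Q.component j i t, y ≠ 0 →
    ∃ p : Path (τ i) j, t + p.length = n + 1 ∧ y * Q.cls p ≠ 0

/-- `kQ / (ρ)` is a stable `n`-translation algebra: its bound quiver is a stable `n`-translation
quiver, and it is `(n + 1, q)`-Koszul for some `q ∈ ℕ ∪ {∞}`. -/
def IsStableTranslationAlgebra (n : ℕ) (τ : Equiv.Perm Q.V) : Prop :=
  Q.IsStableTranslationQuiver n τ ∧ ∃ q : ℕ∞, Q.IsAlmostKoszul (n + 1) q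

/-! ### Complete `τ`-slices -/

/-- There are no oriented cycles. -/
def IsAcyclic : Prop := ∀ (i : Q.V) (p : Path i i), p.length = 0

/-- There are only finitely many `τ`-orbits of vertices. -/
def HasFinitelyManyOrbits (τ : Equiv.Perm Q.V) : Prop :=
  Finite (Quotient (Equiv.Perm.SameCycle.setoid τ))

/-- The set of vertices `S` is that of a complete `τ`-slice: it meets every `τ`-orbit in exactly one
vertex, and it is convex, that is, all vertices on a path between two vertices of `S` are in `S`. -/
structure IsCompleteSlice (τ : Equiv.Perm Q.V) (S : Set Q.V) : Prop where
  existsUnique : ∀ i, ∃! j, j ∈ S ∧ τ.SameCycle i j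
  convex : ∀ (i j l : Q.V), i ∈ S → l ∈ S → Path i j → Path j l → j ∈ S

/-- The vertices of the full subquiver on a set of vertices `S`. -/
@[ext]
structure SubVertex (S : Set Q.V) : Type u where
  val : Q.V
  mem : val ∈ S

/-- The full subquiver on `S`. -/
instance fullSubquiver (S : Set Q.V) : Quiver.{v} (Q.SubVertex S) := ⟨fun i j => i.val ⟶ j.val⟩

/-- The inclusion of the full subquiver on `S`. -/
def incl (S : Set Q.V) : Q.SubVertex S ⥤q Q.V where
  obj i := i.val
  map e := e

theorem length_incl_mapPath (S : Set Q.V) {i j : Q.SubVertex S} (p : Path i j) :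
    ((Q.incl S).mapPath p).length = p.length := by
  induction p with
  | nil => rfl
  | cons p e ih => exact congrArg (· + 1) ih

theorem incl_mapPath_injective (S : Set Q.V) {i j : Q.SubVertex S} :
    Function.Injective ((Q.incl S).mapPath : Path i j → Path i.val j.val) := by
  intro p
  induction p with
  | nil =>
    intro q h
    cases q with
    | nil => rfl
    | cons q e =>
      have h := congrArg Path.length h
      rw [length_incl_mapPath, length_incl_mapPath] at h
      simp at h
  | cons p e ih =>
    intro q h
    cases q with
    | nil =>
      have h := congrArg Path.length h
      rw [length_incl_mapPath, length_incl_mapPath] at h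
      simp at h
    | cons q f =>
      rw [Prefunctor.mapPath_cons, Prefunctor.mapPath_cons, Path.cons.injEq] at h
      obtain ⟨h1, h2, h3⟩ := h
      obtain rfl := SubVertex.ext h1
      obtain rfl := ih (eq_of_heq h2)
      obtain rfl : e = f := eq_of_heq h3
      rfl

/-- The full bound subquiver on a set of vertices `S`: its relations are the relations of `Q` which
are linear combinations of paths of the subquiver.  (If `S` is convex, these are all relations of
`Q` whose source and target lie in `S`.) -/
def slice (S : Set Q.V) : BoundQuiver.{u, v, w} k where
  V := Q.SubVertex S
  quiver := Q.fullSubquiver S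
  finite_hom i j := Q.finite_hom i.val j.val
  rel i j := {r | Finsupp.mapDomain (Q.incl S).mapPath r ∈ Q.rel i.val j.val}
  rel_homogeneous i j r hr := by
    obtain ⟨t, ht, h⟩ := Q.rel_homogeneous i.val j.val _ hr
    refine ⟨t, ht, fun p hp => ?_⟩
    rw [← Q.length_incl_mapPath S]
    have hp' : Finsupp.mapDomain (Q.incl S).mapPath r ((Q.incl S).mapPath p) = r p :=
      Finsupp.mapDomain_apply (Q.incl_mapPath_injective S) r p
    exact h _ (Finsupp.mem_support_iff.2 (hp'.trans_ne (Finsupp.mem_support_iff.1 hp)))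

variable {Q} in
theorem IsCompleteSlice.finite {τ : Equiv.Perm Q.V} {S : Set Q.V} (hS : Q.IsCompleteSlice τ S)
    (h : Q.HasFinitelyManyOrbits τ) : Finite (Q.slice S).V := by
  have h' : Finite (Quotient (Equiv.Perm.SameCycle.setoid τ)) := h
  refine Finite.of_injective (β := Quotient (Equiv.Perm.SameCycle.setoid τ))
    (fun s : Q.SubVertex S => Quotient.mk _ s.val) ?_
  intro a b hab
  have hab' : τ.SameCycle a.val b.val := Quotient.exact hab
  exact SubVertex.ext ((hS.existsUnique a.val).unique ⟨a.mem, Equiv.Perm.SameCycle.refl τ a.val⟩ ⟨b.mem, hab'⟩)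

end BoundQuiver

/-! Let `U` be the algebra of the big quiver with an identity adjoined, `A` the slice algebra, `ψ :
A → U` the non-unital inclusion and `φ : U → A` the map killing all paths that do not have both ends
in the slice `S`. Convexity makes `φ` a ring homomorphism, with `φ (ψ a) = a` and `ψ (φ u) = ψ 1 * u
* ψ 1`. So `A` is at once a corner and a quotient of `U`. The plan is to apply the exact functor `M
↦ ψ 1 • M` to an almost linear resolution of the simple module at a vertex `i` of `S`. Exactness and
degrees are immediate, and two points need an argument.

Projectivity. Every term `P t` of the resolution with `t ≤ q` lives on successors of `i`: the map
leaving `P t` is injective on the generating degree `t`, so supports propagate from the simple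
module up the resolution (`LinearComplex.supported_eq_top`). A successor of `i` outside `S` has no
path back into `S`, since it would then lie between two vertices of `S`. Hence on such a module the
part outside `S` is a submodule, and `ψ 1 • M` is the quotient of `M` by it, that is, the base
change of `M` along `φ`; so it is projective if `M` is (`corner_projective`).

The end of a finite resolution. For `q < ∞` the kernel at `P q` has degree `n + 1 + q`, so it comes
from paths of length `n + 1` acting on generators. After multiplication by `ψ 1` only paths from
successors of `i` into `S` count, and by convexity these start in `S`. A nonzero path of length `n +
1` goes from `τ j` to `j`; as `S` meets each orbit once it would be an oriented cycle
(`IsCompleteSlice.cls_eq_zero`). So the kernel has zero corner, and the resolution of the corner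
stops at `q`.

Finally, the degree zero quotient of `A` is the finite product of the corners of the simple modules
at the vertices of `S`, and linear resolutions are stable under finite products. -/

/-! ## Graded abelian groups -/

section Graded

variable {M N : Type*} [AddCommGroup M] [AddCommGroup N]

/-- The homogeneous component of degree `s`, for an internal grading by additive subgroups. -/
noncomputable def gradedComponent (D : ℕ → AddSubgroup M) (h : DirectSum.IsInternal D) (s : ℕ) :
    M →+ M :=
  letI := h.chooseDecomposition D
  (D s).subtype.comp
    ((DFinsupp.evalAddMonoidHom s).comp (DirectSum.decomposeAddEquiv D).toAddMonoidHom)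

theorem gradedComponent_same (D : ℕ → AddSubgroup M) (h : DirectSum.IsInternal D) {s : ℕ} {m : M}
    (hm : m ∈ D s) : gradedComponent D h s m = m :=
  letI := h.chooseDecomposition D
  DirectSum.decompose_of_mem_same D hm

theorem gradedComponent_ne (D : ℕ → AddSubgroup M) (h : DirectSum.IsInternal D) {s t : ℕ} {m : M}
    (hm : m ∈ D t) (hst : t ≠ s) : gradedComponent D h s m = 0 :=
  letI := h.chooseDecomposition D
  DirectSum.decompose_of_mem_ne D hm hst

theorem eq_zero_of_mem_of_mem (D : ℕ → AddSubgroup M) (h : DirectSum.IsInternal D) {s t : ℕ} {m : M}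
    (hs : m ∈ D s) (ht : m ∈ D t) (hst : s ≠ t) : m = 0 := by
  rw [← gradedComponent_same D h ht, gradedComponent_ne D h hs hst]

/-- A graded retract of an internally graded abelian group is internally graded. -/
theorem isInternal_of_retract (D : ℕ → AddSubgroup M) (E : ℕ → AddSubgroup N) (f : N →+ M)
    (g : M →+ N) (hgf : ∀ x, g (f x) = x) (hf : ∀ s x, x ∈ E s → f x ∈ D s)
    (hg : ∀ s x, x ∈ D s → g x ∈ E s) (h : DirectSum.IsInternal D) : DirectSum.IsInternal E := by
  let F : ∀ s, E s →+ D s := fun s => (f.comp (E s).subtype).codRestrict (D s) fun x => hf s _ x.2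
  let G : ∀ s, D s →+ E s := fun s => (g.comp (D s).subtype).codRestrict (E s) fun x => hg s _ x.2
  -- Both maps of direct sums commute with summation, so injectivity passes back along `F` and
  -- surjectivity forward along `G`.
  have hF : (DirectSum.coeAddMonoidHom D).comp (DirectSum.map F) =
      f.comp (DirectSum.coeAddMonoidHom E) := by
    ext s x
    simp [F]
  have hG : (DirectSum.coeAddMonoidHom E).comp (DirectSum.map G) =
      g.comp (DirectSum.coeAddMonoidHom D) := by
    ext s x
    simp [G]
  constructor
  · intro x y hxy
    refine (DirectSum.map_injective F).2 (fun s a b hab => ?_) (h.1 ?_)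
    · have hab' : f a = f b := congrArg Subtype.val hab
      rw [← Subtype.coe_inj, ← hgf a, hab', hgf]
    · have h1 := DFunLike.congr_fun hF x
      have h2 := DFunLike.congr_fun hF y
      simp only [AddMonoidHom.comp_apply] at h1 h2
      rw [h1, h2, hxy]
  · intro y
    obtain ⟨z, hz⟩ := h.2 (f y)
    refine ⟨DirectSum.map G z, ?_⟩
    have h1 := DFunLike.congr_fun hG z
    simp only [AddMonoidHom.comp_apply] at h1
    rw [h1, hz, hgf]

/-- A finite product of internally graded abelian groups is internally graded. -/
theorem isInternal_pi {ι : Type*} [Finite ι] {M : ι → Type*} [∀ i, AddCommGroup (M i)]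
    (D : ∀ i, ℕ → AddSubgroup (M i)) (h : ∀ i, DirectSum.IsInternal (D i)) :
    DirectSum.IsInternal (fun s => AddSubgroup.pi Set.univ fun i => D i s) := by
  classical
  have := Fintype.ofFinite ι
  let E : ℕ → AddSubgroup (∀ i, M i) := fun s => AddSubgroup.pi Set.univ fun i => D i s
  change DirectSum.IsInternal E
  let F : ∀ i s, E s →+ D i s := fun i s =>
    ((Pi.evalAddMonoidHom M i).comp (E s).subtype).codRestrict (D i s) fun x =>
      AddSubgroup.mem_pi _ |>.1 x.2 i (Set.mem_univ i)
  let G : ∀ i s, D i s →+ E s := fun i s =>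
    ((AddMonoidHom.single M i).comp (D i s).subtype).codRestrict (E s) fun x => by
      rw [AddSubgroup.mem_pi]
      intro j _
      by_cases hij : j = i
      · subst hij
        simp
      · simp [Pi.single_eq_of_ne hij]
  have hF : ∀ i, (DirectSum.coeAddMonoidHom (D i)).comp (DirectSum.map (F i)) =
      (Pi.evalAddMonoidHom M i).comp (DirectSum.coeAddMonoidHom E) := by
    intro i
    ext s x
    simp only [AddMonoidHom.comp_apply, DirectSum.map_of, DirectSum.coeAddMonoidHom_of]
    rfl
  have hG : ∀ i, (DirectSum.coeAddMonoidHom E).comp (DirectSum.map (G i)) =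
      (AddMonoidHom.single M i).comp (DirectSum.coeAddMonoidHom (D i)) := by
    intro i
    refine DirectSum.addHom_ext fun s x => ?_
    simp [G]
  constructor
  · intro x y hxy
    have key : ∀ i, DirectSum.map (F i) x = DirectSum.map (F i) y := by
      intro i
      refine (h i).1 ?_
      have h1 := DFunLike.congr_fun (hF i) x
      have h2 := DFunLike.congr_fun (hF i) y
      simp only [AddMonoidHom.comp_apply] at h1 h2
      rw [h1, h2, hxy]
    refine DFinsupp.ext fun s => Subtype.ext (funext fun i => ?_)
    have h1 := congrArg (fun z => ((z s : D i s) : M i)) (key i)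
    simp only [DirectSum.map_apply] at h1
    exact h1
  · intro y
    choose z hz using fun i => (h i).2 (y i)
    refine ⟨∑ i, DirectSum.map (G i) (z i), ?_⟩
    rw [map_sum]
    have h1 : ∀ i, DirectSum.coeAddMonoidHom E (DirectSum.map (G i) (z i)) = Pi.single i (y i) := by
      intro i
      have h1 := DFunLike.congr_fun (hG i) (z i)
      simp only [AddMonoidHom.comp_apply] at h1
      rw [h1, hz]
      rfl
    simp only [h1]
    exact Finset.univ_sum_single y

end Graded

/-! ## Operations on linear resolutions -/

section Resolutions

variable {k : Type w} [CommRing k] {R : Type x} [Ring R] [Algebra k R] {𝒜 : ℕ → Submodule k R}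

/-- An additive map which vanishes on `r • m`, for `r` homogeneous and `m` in a generating set,
vanishes. -/
theorem eq_zero_of_homogeneous_smul {M G : Type*} [AddCommGroup M] [Module R M] [AddCommGroup G]
    (hR : ∀ r, r ∈ ⨆ t, 𝒜 t) {X : Set M} (hX : Submodule.span R X = ⊤) (f : M →+ G)
    (hf : ∀ t, ∀ r ∈ 𝒜 t, ∀ m ∈ X, f (r • m) = 0) (m : M) : f m = 0 := by
  have hm : m ∈ Submodule.span R X := hX ▸ Submodule.mem_top
  have key : ∀ r : R, ∀ m ∈ X, f (r • m) = 0 := by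
    intro r m hm
    refine Submodule.iSup_induction 𝒜 (motive := fun r => f (r • m) = 0) (hR r)
      (fun t r hr => hf t r hr m hm) (by simp) fun a b ha hb => ?_
    rw [add_smul, map_add, ha, hb, add_zero]
  -- As `f` is only additive, the span is treated as the additive group generated by the products `r
  -- • m`.
  induction hm using Submodule.closure_induction with
  | zero => simp
  | add a b _ _ ha hb => rw [map_add, ha, hb, add_zero]
  | smul_mem r m hm => exact key r m hm

/-- Linear resolutions transport along isomorphisms. -/
theorem HasLinearResolution.of_equiv {S T : Type x} [AddCommGroup S] [Module R S] [AddCommGroup T]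
    [Module R T] (e : S ≃ₗ[R] T) (h : HasLinearResolution 𝒜 S) : HasLinearResolution 𝒜 T := by
  obtain ⟨C, hs, hC⟩ := h
  refine ⟨{ P := C.P, deg := C.deg, isInternal := C.isInternal, smul_mem := C.smul_mem,
            projective := C.projective, generated := C.generated, d := C.d, d_mem := C.d_mem,
            ε := e.toLinearMap ∘ₗ C.ε,
            ε_eq_zero := fun s m h0 hm => by simp [C.ε_eq_zero s m h0 hm] },
          e.surjective.comp hs, fun t => ?_⟩
  have := hC t
  cases t with
  | zero => exact (LinearEquiv.ker_comp _ _).trans this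
  | succ t => exact this

theorem Module.Projective.pi_of_finite {ι : Type*} [Finite ι] (M : ι → Type*)
    [∀ i, AddCommGroup (M i)] [∀ i, Module R (M i)] [∀ i, Module.Projective R (M i)] :
    Module.Projective R (∀ i, M i) := by
  classical
  have := Fintype.ofFinite ι
  exact Module.Projective.of_equiv (DFinsupp.linearEquivFunOnFintype (R := R) (M := M))

end Resolutions

/-- A finite product of modules with linear resolutions has a linear resolution. -/
theorem HasLinearResolution.pi {k : Type w} [CommRing k] {R : Type (max u x)} [Ring R] [Algebra k R]
    {𝒜 : ℕ → Submodule k R} {ι : Type u} [Finite ι] {S : ι → Type (max u x)}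
    [∀ i, AddCommGroup (S i)] [∀ i, Module R (S i)] (h : ∀ i, HasLinearResolution 𝒜 (S i)) :
    HasLinearResolution 𝒜 (∀ i, S i) := by
  classical
  choose C hs hC using h
  have hP : ∀ t i, Module.Projective R ((C i).P t) := fun t i => (C i).projective t
  let D : LinearComplex 𝒜 (∀ i, S i) :=
    { P := fun t => ∀ i, (C i).P t
      deg := fun t s => AddSubgroup.pi Set.univ fun i => (C i).deg t s
      isInternal := fun t => isInternal_pi _ fun i => (C i).isInternal t
      smul_mem := fun t a b r m hr hm => by
        rw [AddSubgroup.mem_pi] at hm ⊢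
        exact fun i hi => (C i).smul_mem t a b r (m i) hr (hm i hi)
      projective := fun t => Module.Projective.pi_of_finite _
      generated := fun t => by
        have := Fintype.ofFinite ι
        rw [eq_top_iff]
        intro m _
        rw [← Finset.univ_sum_single m]
        refine Submodule.sum_mem _ fun i _ => ?_
        have hm : m i ∈ Submodule.span R ((C i).deg t t : Set ((C i).P t)) := by
          rw [(C i).generated t]
          exact Submodule.mem_top
        have hm' := Submodule.mem_map_of_mem (f := LinearMap.single R (fun i => (C i).P t) i) hm
        rw [Submodule.map_span] at hm'
        refine Submodule.span_mono ?_ hm'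
        rintro _ ⟨y, hy, rfl⟩
        rw [SetLike.mem_coe, AddSubgroup.mem_pi]
        intro j _
        by_cases hij : j = i
        · subst hij
          simpa using hy
        · simp [Pi.single_eq_of_ne hij]
      d := fun t => LinearMap.piMap fun i => (C i).d t
      d_mem := fun t s m hm => by
        rw [AddSubgroup.mem_pi] at hm ⊢
        exact fun i hi => (C i).d_mem t s (m i) (hm i hi)
      ε := LinearMap.piMap fun i => (C i).ε
      ε_eq_zero := fun s m h0 hm => by
        rw [AddSubgroup.mem_pi] at hm
        exact funext fun i => (C i).ε_eq_zero s (m i) h0 (hm i (Set.mem_univ i)) }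
  refine ⟨D, fun y => ?_, fun t => ?_⟩
  · choose z hz using fun i => hs i (y i)
    exact ⟨z, funext hz⟩
  · have hker : ∀ m : D.P t, m ∈ D.kerAt t ↔ ∀ i, m i ∈ (C i).kerAt t := by
      intro m
      cases t with
      | zero => exact funext_iff
      | succ t => exact funext_iff
    refine SetLike.ext fun m => ?_
    rw [hker]
    constructor
    · intro hm
      have : ∀ i, ∃ z, (C i).d t z = m i := fun i => by
        have := hm i
        rwa [hC i t] at this
      choose z hz using this
      exact ⟨z, funext hz⟩
    · rintro ⟨z, rfl⟩ i
      rw [hC i t]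
      exact ⟨z i, rfl⟩

/-! ## Corners of modules -/

section Corner

variable {A U : Type*} [Ring A] [Ring U]

/-- For a (non-unital) homomorphism `ψ : A → U`, the part of a `U`-module `M` on which the idempotent
`ψ 1` acts as the identity, cut down to zero if `b` holds. -/
def corner (ψ : A →ₙ+* U) (M : Type*) [AddCommGroup M] [Module U M] (b : Prop) : AddSubgroup M where
  carrier := {m | ψ 1 • m = m ∧ (b → m = 0)}
  zero_mem' := ⟨smul_zero _, fun _ => rfl⟩
  add_mem' := fun {x y} hx hy =>
    ⟨by rw [smul_add, hx.1, hy.1], fun h => by rw [hx.2 h, hy.2 h, add_zero]⟩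
  neg_mem' := fun {x} hx => ⟨by rw [smul_neg, hx.1], fun h => by rw [hx.2 h, neg_zero]⟩

variable (ψ : A →ₙ+* U) {M N : Type*} [AddCommGroup M] [Module U M] [AddCommGroup N] [Module U N]
  {b c : Prop}

theorem map_smul_mem_corner (a : A) {m : M} (hm : m ∈ corner ψ M b) : ψ a • m ∈ corner ψ M b :=
  ⟨by rw [← mul_smul, ← map_mul, one_mul], fun h => by rw [hm.2 h, smul_zero]⟩

theorem one_smul_mem_corner (hb : ¬b) (m : M) : ψ 1 • m ∈ corner ψ M b :=
  ⟨by rw [← mul_smul, ← map_mul, one_mul], fun h => absurd h hb⟩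

instance cornerModule : Module A (corner ψ M b) where
  smul a m := ⟨ψ a • m.1, map_smul_mem_corner ψ a m.2⟩
  one_smul m := Subtype.ext m.2.1
  mul_smul x y m := Subtype.ext (by
    change ψ (x * y) • m.1 = ψ x • ψ y • m.1
    rw [map_mul, mul_smul])
  smul_zero x := Subtype.ext (smul_zero _)
  smul_add x m n := Subtype.ext (smul_add _ _ _)
  add_smul x y m := Subtype.ext (by
    change ψ (x + y) • m.1 = ψ x • m.1 + ψ y • m.1
    rw [map_add, add_smul])
  zero_smul m := Subtype.ext (by
    change ψ 0 • m.1 = 0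
    rw [map_zero, zero_smul])

theorem corner_coe_smul (a : A) (m : corner ψ M b) : ((a • m : corner ψ M b) : M) = ψ a • (m : M) :=
  rfl

/-- The map of corners induced by a linear map. -/
def cornerMap (f : M →ₗ[U] N) (h : c → b) : corner ψ M b →ₗ[A] corner ψ N c where
  toFun m := ⟨f m, by rw [← map_smul, m.2.1], fun hc => by rw [m.2.2 (h hc), map_zero]⟩
  map_add' m n := Subtype.ext (map_add f _ _)
  map_smul' a m := Subtype.ext (map_smul f _ _)

theorem corner_eq_zero (hb : b) (m : corner ψ M b) : m = 0 := Subtype.ext (m.2.2 hb)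

/-- Lifting problems over `A` are solved over `U`. Modules over `A` become modules over `U` through
`φ`, and a map `g` on the corner extends to `M` by `m ↦ g (ψ 1 • m)`. This extension is `U`-linear
by `hM`, which says that `ψ 1 * u` does not see the part of `M` killed by `ψ 1`. A lift on `M`,
restricted to the corner, is `A`-linear because `φ (ψ a) = a`. -/
theorem corner_projective {φ : U →+* A} (hφψ : ∀ a, φ (ψ a) = a)
    (hψφ : ∀ u, ψ (φ u) = ψ 1 * u * ψ 1) (hb : ¬b) [Module.Projective U M]
    (hM : ∀ (u : U) (m : M), (ψ 1 * u) • ψ 1 • m = (ψ 1 * u) • m) [Small.{x} A]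
    {P : Type x} [AddCommGroup P] [Module A P] (e : P ≃ₗ[A] corner ψ M b) :
    Module.Projective A P := by
  refine Module.Projective.of_lifting_property ?_
  intro X Y _ _ _ _ f g hf
  let _ : Module U X := Module.compHom X φ
  let _ : Module U Y := Module.compHom Y φ
  let f' : X →ₗ[U] Y := { f.toAddMonoidHom with map_smul' := fun u x => f.map_smul (φ u) x }
  let g' : M →ₗ[U] Y :=
    { toFun := fun m => g (e.symm ⟨ψ 1 • m, one_smul_mem_corner ψ hb m⟩)
      map_add' := fun m n => by
        rw [← map_add, ← map_add]
        congr 2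
        exact Subtype.ext (smul_add _ _ _)
      map_smul' := fun u m => by
        change _ = φ u • g _
        rw [← map_smul, ← map_smul]
        congr 2
        refine Subtype.ext ?_
        change ψ 1 • u • m = ψ (φ u) • ψ 1 • m
        rw [hψφ, mul_smul _ (ψ 1), ← mul_smul (ψ 1) (ψ 1), ← map_mul, one_mul, hM, mul_smul] }
  obtain ⟨h, hh⟩ := Module.projective_lifting_property f' g' hf
  refine ⟨{ toFun := fun m => h (e m : M)
            map_add' := fun m n => by simp
            map_smul' := fun a m => by
              rw [map_smul, corner_coe_smul, map_smul]
              change φ (ψ a) • h (e m : M) = _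
              rw [hφψ]
              rfl }, ?_⟩
  refine LinearMap.ext fun m => ?_
  have := DFunLike.congr_fun hh (e m : M)
  refine this.trans ?_
  change g (e.symm ⟨ψ 1 • (e m : M), _⟩) = g m
  congr 1
  rw [LinearEquiv.symm_apply_eq]
  exact Subtype.ext (e m).2.1

end Corner

/-! ## Corners of almost linear resolutions -/

section Support

variable {k A U : Type*} [CommRing k] [Ring A] [Ring U] [Algebra k U]

/-- A directed family of elements of `U` of degree zero, which act as local units on a full
subcategory of `U`-modules, and on which the corner at `ψ 1` is convex and annihilates the component
of degree `p`. -/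
structure IsSupportFamily (ψ : A →ₙ+* U) (𝒰 : ℕ → Submodule k U) (p : ℕ) (E : Set U) : Prop where
  nonempty : E.Nonempty
  directed : ∀ e ∈ E, ∀ f ∈ E, ∃ g ∈ E, g * e = e ∧ g * f = f
  stable : ∀ u, ∀ e ∈ E, ∃ g ∈ E, g * (u * e) = u * e
  degree_zero : ∀ e ∈ E, e ∈ 𝒰 0
  convex : ∀ u, ∀ e ∈ E, ψ 1 * u * (ψ 1 * e) = ψ 1 * u * e
  vanish : ∀ u ∈ 𝒰 p, ∀ e ∈ E, ψ 1 * u * e = 0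

variable {ψ : A →ₙ+* U} {𝒰 : ℕ → Submodule k U} {p : ℕ} {E : Set U}

/-- The elements of a module which are fixed by a member of a support family. -/
def IsSupportFamily.supported (h : IsSupportFamily ψ 𝒰 p E) (M : Type*) [AddCommGroup M]
    [Module U M] : Submodule U M where
  carrier := {m | ∃ e ∈ E, e • m = m}
  zero_mem' := ⟨_, h.nonempty.some_mem, smul_zero _⟩
  add_mem' := by
    rintro m n ⟨e, he, hm⟩ ⟨f, hf, hn⟩
    obtain ⟨g, hg, h1, h2⟩ := h.directed e he f hf
    refine ⟨g, hg, ?_⟩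
    rw [smul_add, ← hm, ← hn, ← mul_smul, ← mul_smul, h1, h2]
  smul_mem' := by
    rintro u m ⟨e, he, hm⟩
    obtain ⟨g, hg, h1⟩ := h.stable u e he
    refine ⟨g, hg, ?_⟩
    rw [← hm, ← mul_smul u, ← mul_smul, h1]

theorem IsSupportFamily.mem_supported (h : IsSupportFamily ψ 𝒰 p E) {M : Type*} [AddCommGroup M]
    [Module U M] {m : M} : m ∈ h.supported M ↔ ∃ e ∈ E, e • m = m := Iff.rfl

end Support

/-! ### Supports of the terms of an almost linear resolution, and its restriction to the corner -/

section AlmostLinear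

variable {k : Type w} [CommRing k] {A U : Type x} [Ring A] [Ring U] [Algebra k A] [Algebra k U]
  {ψ : A →ₙ+* U} {𝒰 : ℕ → Submodule k U} {𝒜 : ℕ → Submodule k A} {p : ℕ} {E : Set U}
  {S : Type x} [AddCommGroup S] [Module U S]

/-- A map leaving a term of a linear complex up to which the complex is (almost) exact is injective
on the generating component. -/
theorem LinearComplex.eq_zero_of_mem_kerAt (hU : ∀ r, r ∈ ⨆ t, 𝒰 t) (hp : 0 < p)
    (C : LinearComplex 𝒰 S) (t : ℕ)
    (hC : C.ExactAt t ∨ ∀ m : C.P t, m ∈ C.kerAt t → m ∈ C.deg t (p + t))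
    {m : C.P t} (hm : m ∈ C.deg t t) (hk : m ∈ C.kerAt t) : m = 0 := by
  rcases hC with hC | hC
  · rw [hC] at hk
    obtain ⟨z, rfl⟩ := hk
    -- The image of `d t` has no component of degree `t`: its source is generated in degree `t + 1`
    -- and scalars do not lower degrees.
    rw [← gradedComponent_same _ (C.isInternal t) hm]
    refine eq_zero_of_homogeneous_smul hU (C.generated (t + 1))
      ((gradedComponent _ (C.isInternal t) t).comp (C.d t).toAddMonoidHom) ?_ z
    intro s r hr m hm
    exact gradedComponent_ne _ _ (C.d_mem t _ _ (C.smul_mem _ _ _ r m hr hm)) (by omega)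
  -- The degrees `t` and `p + t` differ because `p` is positive.
  · exact eq_zero_of_mem_of_mem _ (C.isInternal t) hm (hC m hk) (by omega)

-- Induction along the resolution. If `e` fixes the image of a generator `m` of degree `t`, then `e
-- • m - m` is in the kernel; it still has degree `t`, as `e` has degree zero, so it vanishes by
-- injectivity in that degree. No minimality of the resolution is needed.
omit [Algebra k A] in
theorem LinearComplex.supported_eq_top (h : IsSupportFamily ψ 𝒰 p E) (hU : ∀ r, r ∈ ⨆ t, 𝒰 t)
    (hp : 0 < p) (C : LinearComplex 𝒰 S) (hS : ∃ e ∈ E, ∀ s : S, e • s = s) (q : ℕ∞)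
    (hex : ∀ t : ℕ, (t : ℕ∞) < q → C.ExactAt t)
    (hker : ∀ t : ℕ, (t : ℕ∞) = q → ∀ m : C.P t, m ∈ C.kerAt t ↔ m ∈ C.deg t (p + t)) (t : ℕ)
    (ht : (t : ℕ∞) ≤ q) : h.supported (C.P t) = ⊤ := by
  have hC : C.ExactAt t ∨ ∀ m : C.P t, m ∈ C.kerAt t → m ∈ C.deg t (p + t) := by
    rcases ht.lt_or_eq with ht | ht
    · exact Or.inl (hex t ht)
    · exact Or.inr fun m hm => (hker t ht m).1 hm
  rw [eq_top_iff, ← C.generated t, Submodule.span_le]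
  intro m hm
  suffices hm' : ∃ e ∈ E, e • m - m ∈ C.kerAt t by
    obtain ⟨e, he, hk⟩ := hm'
    refine ⟨e, he, ?_⟩
    rw [← sub_eq_zero]
    refine C.eq_zero_of_mem_kerAt hU hp t hC (sub_mem ?_ hm) hk
    have := C.smul_mem t 0 t e m (h.degree_zero e he) hm
    rwa [zero_add] at this
  cases t with
  | zero =>
    obtain ⟨e, he, hS⟩ := hS
    refine ⟨e, he, ?_⟩
    change C.ε _ = 0
    rw [map_sub, map_smul, hS, sub_self]
  | succ t =>
    have ih := C.supported_eq_top h hU hp hS q hex hker t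
      (le_trans (by exact_mod_cast Nat.le_succ t) ht)
    have : C.d t m ∈ h.supported (C.P t) := ih ▸ Submodule.mem_top
    obtain ⟨e, he, hd⟩ := this
    refine ⟨e, he, ?_⟩
    change C.d t _ = 0
    rw [map_sub, map_smul, hd, sub_self]

/-- The corner of an almost linear resolution of a supported module is a linear resolution. -/
theorem HasAlmostLinearResolution.corner {φ : U →+* A} (h : IsSupportFamily ψ 𝒰 p E)
    (hφψ : ∀ a, φ (ψ a) = a) (hψφ : ∀ u, ψ (φ u) = ψ 1 * u * ψ 1)
    (hdeg : ∀ t, ∀ a ∈ 𝒜 t, ψ a ∈ 𝒰 t) (hone : 1 ∈ 𝒜 0)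
    (hU : ∀ r, r ∈ ⨆ t, 𝒰 t) (hp : 0 < p) (hS : ∃ e ∈ E, ∀ s : S, e • s = s) {q : ℕ∞}
    (hR : HasAlmostLinearResolution 𝒰 p q S) :
    HasLinearResolution 𝒜 (corner ψ S False) := by
  obtain ⟨C, hε, hex, hker⟩ := hR
  have hsup : ∀ t : ℕ, (t : ℕ∞) ≤ q → ∀ m : C.P t, ∃ e ∈ E, e • m = m := by
    intro t ht m
    have := C.supported_eq_top h hU hp hS q hex hker t ht
    exact h.mem_supported.1 (this ▸ Submodule.mem_top)
  -- Writing `m = e • m` with `e ∈ E` turns the convexity of the support family into a statement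
  -- about modules.
  have hconv : ∀ t : ℕ, (t : ℕ∞) ≤ q → ∀ (u : U) (m : C.P t),
      (ψ 1 * u) • ψ 1 • m = (ψ 1 * u) • m := by
    intro t ht u m
    obtain ⟨e, he, hm⟩ := hsup t ht m
    rw [← hm, ← mul_smul (ψ 1) e, ← mul_smul, ← mul_smul, h.convex u e he]
  have hpiece : ∀ t s, ∀ m ∈ C.deg t s, ψ 1 • m ∈ C.deg t s := by
    intro t s m hm
    have := C.smul_mem t 0 s (ψ 1) m (hdeg 0 1 hone) hm
    rwa [zero_add] at this
  -- Once a term is cut down to zero so are all later ones, as the differentials of the truncated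
  -- complex require.
  have hmono : ∀ t : ℕ, q < t → q < (t + 1 : ℕ) := fun t ht =>
    ht.trans (by exact_mod_cast Nat.lt_succ_self t)
  -- The truncation condition `q < t` replaces the uncontrolled terms beyond `q` by zero, so finite
  -- and infinite `q` are treated together.
  let P : ℕ → Type x := fun t => _root_.corner ψ (C.P t) (q < t)
  let D : LinearComplex 𝒜 (_root_.corner ψ S False) :=
    { P := P
      addCommGroup := fun t => inferInstanceAs (AddCommGroup (_root_.corner ψ (C.P t) (q < t)))
      module := fun t => inferInstanceAs (Module A (_root_.corner ψ (C.P t) (q < t)))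
      deg := fun t s => (C.deg t s).comap (_root_.corner ψ (C.P t) (q < t)).subtype
      isInternal := fun t => by
        by_cases ht : q < t
        · have : Subsingleton (P t) :=
            ⟨fun a b => (corner_eq_zero ψ ht a).trans (corner_eq_zero ψ ht b).symm⟩
          refine isInternal_of_retract _ _ (0 : P t →+ C.P t) 0 (fun x => Subsingleton.elim _ _)
            (fun s x hx => zero_mem _) (fun s x hx => zero_mem _) (C.isInternal t)
        · refine isInternal_of_retract _ _ (_root_.corner ψ (C.P t) (q < t)).subtype
            { toFun := fun m => ⟨ψ 1 • m, one_smul_mem_corner ψ ht m⟩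
              map_zero' := Subtype.ext (smul_zero _)
              map_add' := fun m n => Subtype.ext (smul_add _ _ _) }
            (fun x => Subtype.ext x.2.1) (fun s x hx => hx) (fun s x hx => hpiece t s x hx)
            (C.isInternal t)
      smul_mem := fun t a b r m hr hm => C.smul_mem t a b (ψ r) _ (hdeg a r hr) hm
      projective := fun t => by
        by_cases ht : q < t
        · have : Subsingleton (P t) :=
            ⟨fun a b => (corner_eq_zero ψ ht a).trans (corner_eq_zero ψ ht b).symm⟩
          infer_instance
        · have := C.projective t
          exact corner_projective ψ hφψ hψφ ht (hconv t (not_lt.1 ht)) (LinearEquiv.refl A _)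
      generated := fun t => by
        by_cases ht : q < t
        · refine eq_top_iff.2 fun m _ => ?_
          rw [corner_eq_zero ψ ht m]
          exact zero_mem _
        · let T : Submodule A (_root_.corner ψ (C.P t) (q < t)) := Submodule.span A
            ((C.deg t t).comap (_root_.corner ψ (C.P t) (q < t)).subtype :
              Set (_root_.corner ψ (C.P t) (q < t)))
          change T = ⊤
          refine eq_top_iff.2 fun m _ => ?_
          -- The corner consists of the elements `ψ 1 • z`. By `hconv`, `ψ 1 • r • m` equals `φ r`
          -- acting on `ψ 1 • m`, so the images of generators generate.
          have key : ∀ z : C.P t, (⟨ψ 1 • z, one_smul_mem_corner ψ ht z⟩ :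
              _root_.corner ψ (C.P t) (q < t)) ∈ T := by
            intro z
            have hz : z ∈ Submodule.span U (C.deg t t : Set (C.P t)) := by
              rw [C.generated t]
              exact Submodule.mem_top
            induction hz using Submodule.closure_induction with
            | zero =>
              convert zero_mem T
              exact smul_zero _
            | add a b _ _ ha hb =>
              convert add_mem ha hb
              exact smul_add _ _ _
            | smul_mem r m hm =>
              have h1 : (⟨ψ 1 • m, one_smul_mem_corner ψ ht m⟩ :
                  _root_.corner ψ (C.P t) (q < t)) ∈ T := Submodule.subset_span (hpiece t t m hm)
              convert T.smul_mem (φ r) h1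
              refine (?_ : ψ 1 • r • m = ψ (φ r) • ψ 1 • m)
              rw [hψφ, mul_smul _ (ψ 1), ← mul_smul (ψ 1) (ψ 1), ← map_mul, one_mul,
                hconv t (not_lt.1 ht), mul_smul]
          have := key m.1
          convert this
          exact m.2.1.symm
      d := fun t => cornerMap ψ (C.d t) (hmono t)
      d_mem := fun t s m hm => C.d_mem t s _ hm
      ε := cornerMap ψ C.ε False.elim
      ε_eq_zero := fun s m h0 hm => Subtype.ext (C.ε_eq_zero s _ h0 hm) }
  have hkerAt : ∀ t (m : D.P t), m ∈ D.kerAt t ↔ (m : C.P t) ∈ C.kerAt t := by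
    intro t m
    cases t with
    | zero => exact Subtype.ext_iff
    | succ t => exact Subtype.ext_iff
  refine ⟨D, fun y => ?_, fun t => SetLike.ext fun m => ?_⟩
  · obtain ⟨z, hz⟩ := hε y.1
    refine ⟨⟨ψ 1 • z, one_smul_mem_corner ψ (by simp) z⟩, Subtype.ext ?_⟩
    change C.ε (ψ 1 • z) = y
    rw [map_smul, hz, y.2.1]
  · rw [hkerAt]
    rcases lt_trichotomy (t : ℕ∞) q with ht | ht | ht
    · have ht' : ¬ q < (t + 1 : ℕ) := by
        rw [not_lt]
        exact_mod_cast Order.add_one_le_of_lt ht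
      have := hex t ht
      constructor
      · intro hm
        rw [this] at hm
        obtain ⟨z, hz⟩ := hm
        -- Exactness of the corner functor: a preimage is moved into the corner by `ψ 1`.
        refine ⟨⟨ψ 1 • z, one_smul_mem_corner ψ ht' z⟩, Subtype.ext ?_⟩
        change C.d t (ψ 1 • z) = m.1
        rw [map_smul, hz, m.2.1]
      · rintro ⟨z, rfl⟩
        rw [this]
        exact ⟨z.1, rfl⟩
    · have ht' : q < (t + 1 : ℕ) := ht ▸ (by exact_mod_cast Nat.lt_succ_self t)
      constructor
      · intro hm
        have hm' := (hker t ht m.1).1 hm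
        -- The next term is zero, so the kernel must vanish. Being of degree `p + t`, the element
        -- `m.1` is the image of itself under `ψ 1` composed with the projection to that degree. On
        -- `r • m`, with `m` a generator, this map can be nonzero only for `r` of degree `p`, where
        -- `vanish` applies.
        have h0 : m.1 = 0 := by
          rw [← m.2.1, ← gradedComponent_same _ (C.isInternal t) hm']
          refine eq_zero_of_homogeneous_smul hU (C.generated t)
            ((DistribSMul.toAddMonoidHom (C.P t) (ψ 1)).comp
              (gradedComponent _ (C.isInternal t) (p + t))) ?_ m.1
          intro s r hr m hm
          change ψ 1 • gradedComponent _ (C.isInternal t) (p + t) (r • m) = 0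
          have hrm := C.smul_mem t s t r m hr hm
          by_cases hs : s = p
          · subst hs
            obtain ⟨e, he, hem⟩ := hsup t ht.le m
            rw [gradedComponent_same _ _ hrm, ← hem, ← mul_smul, ← mul_smul,
              h.vanish r hr e he, zero_smul]
          · rw [gradedComponent_ne _ _ hrm (by omega), smul_zero]
        have : m = 0 := Subtype.ext h0
        rw [this]
        exact zero_mem _
      · rintro ⟨z, rfl⟩
        have : z = 0 := corner_eq_zero ψ ht' z
        rw [this, map_zero]
        exact zero_mem _
    · have : m = 0 := corner_eq_zero ψ ht m
      rw [this]
      exact iff_of_true (zero_mem _) (zero_mem _)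

end AlmostLinear

namespace BoundQuiver

open Quiver

variable {k : Type w} [Field k] (Q : BoundQuiver.{u, v, w} k)

/-! ## The slice algebra as a corner and as a quotient -/

section Slice

variable (S : Set Q.V)

/-- The inclusion of a full bound subquiver. -/
def sliceHom : (Q.slice S).V ⥤q Q.V := Q.incl S

theorem sliceHom_obj_injective : Function.Injective (Q.sliceHom S).obj :=
  fun _ _ h => SubVertex.ext h

theorem sliceHom_obj_mem (i : (Q.slice S).V) : (Q.sliceHom S).obj i ∈ S := SubVertex.mem i

theorem sliceHom_mapPath_injective {i j : (Q.slice S).V} :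
    Function.Injective ((Q.sliceHom S).mapPath : Path i j → _) := Q.incl_mapPath_injective S

theorem length_sliceHom_mapPath {i j : (Q.slice S).V} (p : Path i j) :
    ((Q.sliceHom S).mapPath p).length = p.length := Q.length_incl_mapPath S p

/-- The inclusion of the paths of a full subquiver. -/
def inclPaths (p : (Q.slice S).Paths) : Q.Paths :=
  ⟨(Q.sliceHom S).obj p.1, (Q.sliceHom S).obj p.2.1, (Q.sliceHom S).mapPath p.2.2⟩

theorem inclPaths_injective : Function.Injective (Q.inclPaths S) := by
  rintro ⟨i, j, p⟩ ⟨i', j', p'⟩ h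
  simp only [inclPaths, Sigma.mk.injEq] at h
  obtain ⟨h1, h2⟩ := h
  obtain rfl := Q.sliceHom_obj_injective S h1
  obtain ⟨h3, h4⟩ := Sigma.mk.inj (eq_of_heq h2)
  obtain rfl := Q.sliceHom_obj_injective S h3
  obtain rfl := Q.sliceHom_mapPath_injective S (eq_of_heq h4)
  rfl

theorem lmapDomain_inclPaths_conj {a b i j : (Q.slice S).V} (p : Path i a) (q : Path b j)
    (r : Path a b →₀ k) :
    Finsupp.lmapDomain k k (Q.inclPaths S) ((Q.slice S).conj p q r) =
      Q.conj ((Q.sliceHom S).mapPath p) ((Q.sliceHom S).mapPath q)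
        (Finsupp.mapDomain (Q.sliceHom S).mapPath r) := by
  induction r using Finsupp.induction_linear with
  | zero => simp
  | add f g hf hg => rw [map_add, map_add, hf, hg, Finsupp.mapDomain_add, map_add]
  | single m c =>
    rw [conj_single, Finsupp.mapDomain_single, conj_single, map_smul, ofPath, ofPath,
      Finsupp.lmapDomain_apply, Finsupp.mapDomain_single, inclPaths]
    simp only [Prefunctor.mapPath_comp]

/-- The linear map from the slice algebra to the algebra of the quiver induced by the inclusion of
paths. -/
noncomputable def sliceIncl : (Q.slice S).Alg →ₗ[k] Q.Alg :=
  (Q.slice S).algLift (Q.toAlg ∘ₗ Finsupp.lmapDomain k k (Q.inclPaths S)) (by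
    change (Q.slice S).relIdeal ≤ LinearMap.ker _
    rw [relIdeal, Submodule.span_le]
    rintro _ ⟨a, b, i, j, p, r, q, hr, rfl⟩
    rw [SetLike.mem_coe, LinearMap.mem_ker, LinearMap.comp_apply, lmapDomain_inclPaths_conj,
      toAlg_eq_zero]
    exact Submodule.subset_span ⟨_, _, _, _, _, _, _, hr, rfl⟩)

theorem sliceIncl_cls {i j : (Q.slice S).V} (p : Path i j) :
    Q.sliceIncl S ((Q.slice S).cls p) = Q.cls ((Q.sliceHom S).mapPath p) := by
  rw [sliceIncl, cls, algLift_toAlg, LinearMap.comp_apply, ofPath, Finsupp.lmapDomain_apply,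
    Finsupp.mapDomain_single]
  rfl

theorem sliceIncl_mul (x y : (Q.slice S).Alg) :
    Q.sliceIncl S (x * y) = Q.sliceIncl S x * Q.sliceIncl S y := by
  refine (Q.slice S).alg_induction x (by simp)
    (fun a b ha hb => by rw [add_mul, map_add, ha, hb, map_add, add_mul])
    (fun c b hb => by rw [smul_mul_assoc, map_smul, hb, map_smul, smul_mul_assoc]) fun c d q => ?_
  refine (Q.slice S).alg_induction y (by simp)
    (fun a b ha hb => by rw [mul_add, map_add, ha, hb, map_add, mul_add])
    (fun c b hb => by rw [mul_smul_comm, map_smul, hb, map_smul, mul_smul_comm]) fun a b p => ?_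
  by_cases h : c = b
  · subst h
    rw [cls_mul_cls, sliceIncl_cls, sliceIncl_cls, sliceIncl_cls, Prefunctor.mapPath_comp]
    exact (Q.cls_mul_cls _ _).symm
  · rw [cls_mul_cls_ne _ _ _ h, map_zero, sliceIncl_cls, sliceIncl_cls]
    exact (Q.cls_mul_cls_ne _ _ fun h' => h (Q.sliceHom_obj_injective S h')).symm

/-! ### Convexity and the projection onto the slice algebra -/

variable {S}

/-- A set of vertices is convex if it contains all vertices on paths between its members. -/
def IsConvex (S : Set Q.V) : Prop :=
  ∀ i j l : Q.V, i ∈ S → l ∈ S → Path i j → Path j l → j ∈ S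

variable {Q}

/-- Convexity, applied at the last arrow, puts the penultimate vertex in `S`, and the induction
continues from there. -/
theorem IsConvex.exists_mapPath (hS : Q.IsConvex S) {a b : Q.V} (p : Path a b) (ha : a ∈ S)
    (hb : b ∈ S) :
    ∃ p' : Path (V := (Q.slice S).V) (SubVertex.mk a ha) (SubVertex.mk b hb),
      (Q.sliceHom S).mapPath p' = p := by
  induction p with
  | nil => exact ⟨Path.nil, rfl⟩
  | @cons c d p e ih =>
    obtain ⟨p', hp'⟩ := ih (hS a c d ha hb p e.toPath)
    exact ⟨p'.cons e, congrArg (fun z => Path.cons z e) hp'⟩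

variable (Q) in
/-- The linear map to the path algebra of a full subquiver which kills all other paths. -/
noncomputable def restrictPaths (S : Set Q.V) : Q.PathSpace →ₗ[k] (Q.slice S).PathSpace :=
  Finsupp.lcomapDomain (Q.inclPaths S) (Q.inclPaths_injective S)

theorem restrictPaths_lmapDomain (x : (Q.slice S).PathSpace) :
    Q.restrictPaths S (Finsupp.lmapDomain k k (Q.inclPaths S) x) = x :=
  Finsupp.comapDomain_mapDomain _ (Q.inclPaths_injective S) x

theorem restrictPaths_ofPath_of_notMem {i j : Q.V} (p : Path i j) (h : i ∉ S ∨ j ∉ S) :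
    Q.restrictPaths S (Q.ofPath p) = 0 := by
  refine Finsupp.ext fun x => ?_
  change Finsupp.single (⟨i, j, p⟩ : Q.Paths) (1 : k) (Q.inclPaths S x) = 0
  refine Finsupp.single_eq_of_ne ?_
  rintro h'
  have h1 : (Q.sliceHom S).obj x.1 = i := congrArg Sigma.fst h'
  have h2 : (Q.sliceHom S).obj x.2.1 = j := congrArg (fun y : Q.Paths => y.2.1) h'
  rcases h with h | h
  · exact h (h1 ▸ Q.sliceHom_obj_mem S x.1)
  · exact h (h2 ▸ Q.sliceHom_obj_mem S x.2.1)

theorem restrictPaths_conj_of_notMem {a b i j : Q.V} (p : Path i a) (q : Path b j)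
    (r : Path a b →₀ k) (h : i ∉ S ∨ j ∉ S) : Q.restrictPaths S (Q.conj p q r) = 0 := by
  induction r using Finsupp.induction_linear with
  | zero => simp
  | add f g hf hg => rw [map_add, map_add, hf, hg, add_zero]
  | single m c => rw [conj_single, map_smul, restrictPaths_ofPath_of_notMem _ h, smul_zero]

/-- The linear map to the algebra of a convex full subquiver which kills all other paths. -/
noncomputable def sliceProj (hS : Q.IsConvex S) : Q.Alg →ₗ[k] (Q.slice S).Alg :=
  Q.algLift ((Q.slice S).toAlg ∘ₗ Q.restrictPaths S) (by
    change Q.relIdeal ≤ LinearMap.ker _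
    rw [relIdeal, Submodule.span_le]
    rintro _ ⟨a, b, i, j, p, r, q, hr, rfl⟩
    rw [SetLike.mem_coe, LinearMap.mem_ker, LinearMap.comp_apply]
    by_cases h : i ∉ S ∨ j ∉ S
    · rw [restrictPaths_conj_of_notMem _ _ _ h, map_zero]
    push Not at h
    obtain ⟨hi, hj⟩ := h
    -- A nonzero relation supplies a path `m` from `a` to `b`. Then `a` and `b` lie on a path from
    -- `i` to `j`, so they are in `S`, and the whole generator comes from one of the relation ideal
    -- of the slice.
    by_cases hr0 : r = 0
    · simp [hr0]
    obtain ⟨m, -⟩ := Finsupp.support_nonempty_iff.2 hr0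
    have ha : a ∈ S := hS i a j hi hj p (m.comp q)
    have hb : b ∈ S := hS i b j hi hj (p.comp m) q
    obtain ⟨p, rfl⟩ := hS.exists_mapPath p hi ha
    obtain ⟨q, rfl⟩ := hS.exists_mapPath q hb hj
    obtain ⟨r, rfl⟩ := Finsupp.mapDomain_surjective
      (fun m => hS.exists_mapPath m ha hb) r
    have := Q.lmapDomain_inclPaths_conj S p q r
    refine (congrArg _ (congrArg (Q.restrictPaths S) this.symm)).trans ?_
    rw [restrictPaths_lmapDomain, toAlg_eq_zero]
    exact Submodule.subset_span ⟨_, _, _, _, p, r, q, hr, rfl⟩)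

theorem sliceProj_sliceIncl (hS : Q.IsConvex S) (x : (Q.slice S).Alg) :
    sliceProj hS (Q.sliceIncl S x) = x := by
  obtain ⟨x, rfl⟩ := (Q.slice S).toAlg_surjective x
  rw [sliceIncl, algLift_toAlg, LinearMap.comp_apply, sliceProj, algLift_toAlg,
    LinearMap.comp_apply, restrictPaths_lmapDomain]

theorem sliceProj_cls_of_notMem (hS : Q.IsConvex S) {i j : Q.V} (p : Path i j)
    (h : i ∉ S ∨ j ∉ S) : sliceProj hS (Q.cls p) = 0 := by
  rw [sliceProj, cls, algLift_toAlg, LinearMap.comp_apply, restrictPaths_ofPath_of_notMem _ h,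
    map_zero]

theorem IsConvex.exists_sliceIncl (hS : Q.IsConvex S) {i j : Q.V} (p : Path i j) (hi : i ∈ S)
    (hj : j ∈ S) : ∃ x, Q.sliceIncl S x = Q.cls p := by
  obtain ⟨p, rfl⟩ := hS.exists_mapPath p hi hj
  exact ⟨_, Q.sliceIncl_cls S p⟩

/-- The danger is a composite with both ends in `S` that passes through a junction outside `S`: it
would survive while its factors are killed. Convexity excludes exactly this. -/
theorem sliceProj_mul (hS : Q.IsConvex S) (x y : Q.Alg) :
    sliceProj hS (x * y) = sliceProj hS x * sliceProj hS y := by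
  refine Q.alg_induction x (by simp)
    (fun a b ha hb => by rw [add_mul, map_add, ha, hb, map_add, add_mul])
    (fun c b hb => by rw [smul_mul_assoc, map_smul, hb, map_smul, smul_mul_assoc]) fun c d q => ?_
  refine Q.alg_induction y (by simp)
    (fun a b ha hb => by rw [mul_add, map_add, ha, hb, map_add, mul_add])
    (fun c b hb => by rw [mul_smul_comm, map_smul, hb, map_smul, mul_smul_comm]) fun a b p => ?_
  by_cases ha : a ∈ S
  swap
  · rw [sliceProj_cls_of_notMem hS p (Or.inl ha), mul_zero]
    by_cases h : c = b
    · subst h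
      rw [cls_mul_cls, sliceProj_cls_of_notMem hS _ (Or.inl ha)]
    · rw [cls_mul_cls_ne _ _ _ h, map_zero]
  by_cases hd : d ∈ S
  swap
  · rw [sliceProj_cls_of_notMem hS q (Or.inr hd), zero_mul]
    by_cases h : c = b
    · subst h
      rw [cls_mul_cls, sliceProj_cls_of_notMem hS _ (Or.inr hd)]
    · rw [cls_mul_cls_ne _ _ _ h, map_zero]
  by_cases h : c = b ∧ b ∈ S
  · obtain ⟨rfl, hb⟩ := h
    obtain ⟨x, hx⟩ := hS.exists_sliceIncl p ha hb
    obtain ⟨y, hy⟩ := hS.exists_sliceIncl q hb hd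
    rw [← hx, ← hy, ← sliceIncl_mul, sliceProj_sliceIncl, sliceProj_sliceIncl, sliceProj_sliceIncl]
  · by_cases hcb : c = b
    · subst hcb
      exact absurd ⟨rfl, hS a c d ha hd p q⟩ h
    · rw [cls_mul_cls_ne _ _ _ hcb, map_zero]
      by_cases hb : b ∈ S
      · by_cases hc : c ∈ S
        · obtain ⟨x, hx⟩ := hS.exists_sliceIncl p ha hb
          obtain ⟨y, hy⟩ := hS.exists_sliceIncl q hc hd
          -- Two paths of the slice that do not compose: their product vanishes in the large
          -- algebra, and `sliceProj` carries this back to the slice.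
          have h0 := Q.cls_mul_cls_ne q p hcb
          rw [← hx, ← hy, ← sliceIncl_mul] at h0
          rw [← hx, ← hy, sliceProj_sliceIncl, sliceProj_sliceIncl, ← sliceProj_sliceIncl hS (y * x),
            h0, map_zero]
        · rw [sliceProj_cls_of_notMem hS q (Or.inl hc), zero_mul]
      · rw [sliceProj_cls_of_notMem hS p (Or.inr hb), mul_zero]

theorem sliceIncl_mem_degree {t : ℕ} {x : (Q.slice S).Alg} (hx : x ∈ (Q.slice S).degree t) :
    Q.sliceIncl S x ∈ Q.degree t := by
  have : (Q.slice S).degree t ≤ (Q.degree t).comap (Q.sliceIncl S) := by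
    rw [degree, Submodule.span_le]
    rintro _ ⟨i, j, p, rfl, rfl⟩
    rw [SetLike.mem_coe, Submodule.mem_comap, sliceIncl_cls, ← Q.length_sliceHom_mapPath S]
    exact Q.cls_mem_degree _
  exact this hx

/-! ### The identity of the slice algebra as an idempotent of the unitization -/

section Unital

variable [Finite (Q.slice S).V]

variable (Q S) in
/-- The inclusion of the slice algebra in the algebra with an identity adjoined. -/
noncomputable def cornerHom : (Q.slice S).Alg →ₙ+* Unitization k Q.Alg where
  toFun x := (Q.sliceIncl S x : Unitization k Q.Alg)
  map_zero' := by simp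
  map_add' x y := by simp
  map_mul' x y := by rw [sliceIncl_mul, Unitization.inr_mul]

theorem cornerHom_apply (x : (Q.slice S).Alg) :
    Q.cornerHom S x = (Q.sliceIncl S x : Unitization k Q.Alg) := rfl

/-- The projection onto the algebra of a convex full subquiver. -/
noncomputable def cornerProj (hS : Q.IsConvex S) : Unitization k Q.Alg →ₐ[k] (Q.slice S).Alg :=
  Unitization.lift
    { toFun := sliceProj hS
      map_smul' := fun c x => map_smul _ c x
      map_zero' := map_zero _
      map_add' := map_add _
      map_mul' := sliceProj_mul hS }

theorem cornerProj_inr (hS : Q.IsConvex S) (x : Q.Alg) :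
    cornerProj hS (x : Unitization k Q.Alg) = sliceProj hS x := by
  simp [cornerProj]

theorem cornerProj_cornerHom (hS : Q.IsConvex S) (x : (Q.slice S).Alg) :
    cornerProj hS (Q.cornerHom S x) = x := by
  rw [cornerHom_apply, cornerProj_inr, sliceProj_sliceIncl]

theorem sliceIncl_one_mul_cls {i j : Q.V} (p : Path i j) (hj : j ∈ S) :
    Q.sliceIncl S 1 * Q.cls p = Q.cls p := by
  have h : Q.sliceIncl S 1 * Q.idem j = Q.idem j := by
    have := Q.sliceIncl_cls S
      (Path.nil : Path (V := (Q.slice S).V) (SubVertex.mk j hj) (SubVertex.mk j hj))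
    change _ = Q.idem j at this
    rw [← this, ← sliceIncl_mul, one_mul]
  have h' : Q.idem j * Q.cls p = Q.cls p := by rw [idem, cls_mul_cls, Path.comp_nil]
  rw [← h', ← mul_assoc, h]

theorem cls_mul_sliceIncl_one {i j : Q.V} (p : Path i j) (hi : i ∈ S) :
    Q.cls p * Q.sliceIncl S 1 = Q.cls p := by
  have h : Q.idem i * Q.sliceIncl S 1 = Q.idem i := by
    have := Q.sliceIncl_cls S
      (Path.nil : Path (V := (Q.slice S).V) (SubVertex.mk i hi) (SubVertex.mk i hi))
    change _ = Q.idem i at this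
    rw [← this, ← sliceIncl_mul, mul_one]
  have h' : Q.cls p * Q.idem i = Q.cls p := by rw [idem, cls_mul_cls, Path.nil_comp]
  rw [← h', mul_assoc, h]

theorem sliceIncl_one [Fintype (Q.slice S).V] :
    Q.sliceIncl S 1 = ∑ i : (Q.slice S).V, Q.idem ((Q.sliceHom S).obj i) := by
  rw [one_def, map_sum]
  exact Finset.sum_congr rfl fun i _ => Q.sliceIncl_cls S _

theorem sliceIncl_one_mul_cls_of_notMem {i j : Q.V} (p : Path i j) (hj : j ∉ S) :
    Q.sliceIncl S 1 * Q.cls p = 0 := by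
  have := Fintype.ofFinite (Q.slice S).V
  rw [sliceIncl_one, Finset.sum_mul]
  refine Finset.sum_eq_zero fun l _ => Q.cls_mul_cls_ne _ _ ?_
  rintro rfl
  exact hj (Q.sliceHom_obj_mem S l)

theorem cls_mul_sliceIncl_one_of_notMem {i j : Q.V} (p : Path i j) (hi : i ∉ S) :
    Q.cls p * Q.sliceIncl S 1 = 0 := by
  have := Fintype.ofFinite (Q.slice S).V
  rw [sliceIncl_one, Finset.mul_sum]
  refine Finset.sum_eq_zero fun l _ => Q.cls_mul_cls_ne _ _ ?_
  rintro rfl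
  exact hi (Q.sliceHom_obj_mem S l)

/-- Induction on elements of the algebra with an identity adjoined. -/
@[elab_as_elim]
theorem unitization_induction {C : Unitization k Q.Alg → Prop} (u : Unitization k Q.Alg)
    (hone : C 1) (hadd : ∀ x y, C x → C y → C (x + y)) (hsmul : ∀ (a : k) x, C x → C (a • x))
    (hp : ∀ (i j : Q.V) (p : Path i j), C (Q.cls p : Unitization k Q.Alg)) : C u := by
  induction u using Unitization.ind with
  | inl_add_inr r a =>
    refine hadd _ _ ?_ ?_
    · have := hsmul r 1 hone
      rwa [← Algebra.algebraMap_eq_smul_one] at this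
    · refine Q.alg_induction a ?_ ?_ ?_ hp
      · simpa using hsmul 0 1 hone
      · intro x y hx hy
        simpa using hadd _ _ hx hy
      · intro c x hx
        simpa using hsmul c _ hx

/-- On a path both sides are the path itself if both its ends are in `S`, and zero otherwise; on the
adjoined identity both are the idempotent of the slice. -/
theorem cornerHom_cornerProj (hS : Q.IsConvex S) (u : Unitization k Q.Alg) :
    Q.cornerHom S (cornerProj hS u) = Q.cornerHom S 1 * u * Q.cornerHom S 1 := by
  refine Q.unitization_induction u ?_ ?_ ?_ ?_
  · rw [map_one, mul_one, ← map_mul, one_mul]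
  · intro x y hx hy
    rw [map_add, map_add, hx, hy, mul_add, add_mul]
  · intro c x hx
    rw [map_smul, mul_smul_comm, smul_mul_assoc, ← hx, cornerHom_apply, cornerHom_apply, map_smul,
      Unitization.inr_smul]
  · intro i j p
    rw [cornerProj_inr, cornerHom_apply, cornerHom_apply, ← Unitization.inr_mul,
      ← Unitization.inr_mul, Unitization.inr_injective.eq_iff]
    by_cases h : i ∈ S ∧ j ∈ S
    · rw [sliceIncl_one_mul_cls p h.2, cls_mul_sliceIncl_one p h.1]
      obtain ⟨x, hx⟩ := hS.exists_sliceIncl p h.1 h.2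
      rw [← hx, sliceProj_sliceIncl]
    · have h' : i ∉ S ∨ j ∉ S := by tauto
      rw [sliceProj_cls_of_notMem hS p h', map_zero]
      rcases h' with h' | h'
      · rw [mul_assoc, cls_mul_sliceIncl_one_of_notMem p h', mul_zero]
      · rw [sliceIncl_one_mul_cls_of_notMem p h', zero_mul]

end Unital

end Slice

end BoundQuiver

namespace BoundQuiver

open Quiver

variable {k : Type w} [Field k] (Q : BoundQuiver.{u, v, w} k)

/-! ## Supports of modules over the algebra of an infinite quiver -/

/-- The sum of the idempotents at finitely many vertices. -/
noncomputable def idemSum (F : Finset Q.V) : Unitization k Q.Alg :=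
  ∑ j ∈ F, (Q.idem j : Unitization k Q.Alg)

variable {Q}

theorem idem_mul_cls {i j : Q.V} (p : Path i j) : Q.idem j * Q.cls p = Q.cls p := by
  rw [idem, cls_mul_cls, Path.comp_nil]

theorem cls_mul_idem {i j : Q.V} (p : Path i j) : Q.cls p * Q.idem i = Q.cls p := by
  rw [idem, cls_mul_cls, Path.nil_comp]

theorem idemSum_mul_cls {F : Finset Q.V} {i j : Q.V} (p : Path i j) (hj : j ∈ F) :
    Q.idemSum F * (Q.cls p : Unitization k Q.Alg) = Q.cls p := by
  rw [idemSum, Finset.sum_mul, Finset.sum_eq_single_of_mem j hj, ← Unitization.inr_mul,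
    idem_mul_cls]
  intro l _ hl
  rw [← Unitization.inr_mul, idem, cls_mul_cls_ne _ _ _ hl, Unitization.inr_zero]

theorem cls_mul_idemSum {F : Finset Q.V} {i j : Q.V} (p : Path i j) (hi : i ∈ F) :
    (Q.cls p : Unitization k Q.Alg) * Q.idemSum F = Q.cls p := by
  rw [idemSum, Finset.mul_sum, Finset.sum_eq_single_of_mem i hi, ← Unitization.inr_mul,
    cls_mul_idem]
  intro l _ hl
  rw [← Unitization.inr_mul, idem, cls_mul_cls_ne _ _ _ hl.symm, Unitization.inr_zero]

theorem cls_mul_idemSum_of_notMem {F : Finset Q.V} {i j : Q.V} (p : Path i j) (hi : i ∉ F) :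
    (Q.cls p : Unitization k Q.Alg) * Q.idemSum F = 0 := by
  rw [idemSum, Finset.mul_sum]
  refine Finset.sum_eq_zero fun l hl => ?_
  rw [← Unitization.inr_mul, idem, cls_mul_cls_ne, Unitization.inr_zero]
  rintro rfl
  exact hi hl

theorem idemSum_mul_idemSum {F G : Finset Q.V} (h : F ⊆ G) :
    Q.idemSum G * Q.idemSum F = Q.idemSum F := by
  conv_lhs => rw [idemSum.eq_def Q F, Finset.mul_sum]
  exact Finset.sum_congr rfl fun j hj => idemSum_mul_cls Path.nil (h hj)

theorem inr_mem_unitDegree {t : ℕ} {x : Q.Alg} (hx : x ∈ Q.degree t) :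
    (x : Unitization k Q.Alg) ∈ Q.unitDegree t :=
  Submodule.mem_sup_left ⟨x, hx, rfl⟩

theorem mem_iSup_unitDegree (u : Unitization k Q.Alg) : u ∈ ⨆ t, Q.unitDegree t := by
  refine Q.unitization_induction u ?_ ?_ ?_ ?_
  · refine Submodule.mem_iSup_of_mem 0 (Submodule.mem_sup_right ?_)
    rw [if_pos rfl]
    exact Submodule.mem_span_singleton_self _
  · exact fun x y => add_mem
  · exact fun a x => Submodule.smul_mem _ a
  · exact fun i j p => Submodule.mem_iSup_of_mem _ (inr_mem_unitDegree (Q.cls_mem_degree p))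

variable (Q) in
/-- The sums of idempotents at finite sets of vertices which are reachable from `i`. -/
def reachableIdems (i : Q.V) : Set (Unitization k Q.Alg) :=
  {e | ∃ F : Finset Q.V, (∀ j ∈ F, Nonempty (Path i j)) ∧ e = Q.idemSum F}

/-- In an acyclic stable translation quiver, paths of maximal length do not have both ends in a
complete slice. -/
theorem IsCompleteSlice.cls_eq_zero {n : ℕ} {τ : Equiv.Perm Q.V}
    (hQ : Q.IsStableTranslationQuiver n τ) (hdeg : ∀ t, n + 1 < t → Q.degree t = ⊥)
    (hacyclic : Q.IsAcyclic) {S : Set Q.V} (hS : Q.IsCompleteSlice τ S) {i j : Q.V} (p : Path i j)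
    (hp : p.length = n + 1) (hi : i ∈ S) (hj : j ∈ S) : Q.cls p = 0 := by
  by_contra h
  have hlong : ∀ (a b : Q.V) (q : Path a b), q.length = n + 2 → Q.cls q = 0 := by
    intro a b q hq
    have := Q.cls_mem_degree q
    rwa [hq, hdeg _ (by omega), Submodule.mem_bot] at this
  -- Paths of length `n + 2` vanish, so a nonzero path of length `n + 1` is a maximal bound path and
  -- its source is `τ j`.
  obtain ⟨-, h2⟩ := hQ.maximal i j p ⟨h,
    fun l α => hlong _ _ _ (by rw [Path.length_comp, hp]; rfl),
    fun l α => hlong _ _ _ (by rw [Path.length_comp, hp, Path.length_toPath]; omega)⟩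
  -- Both ends are in the slice and in one `τ`-orbit, so they coincide, and `p` is an oriented cycle
  -- of positive length.
  have hij : i = j := (hS.existsUnique j).unique
    ⟨hi, h2 ▸ (Equiv.Perm.SameCycle.refl τ j).apply_right⟩ ⟨hj, Equiv.Perm.SameCycle.refl τ j⟩
  subst hij
  have := hacyclic i p
  omega

/-- The vertices reachable from `i` may be infinite in number, hence a directed family of finite
sums in place of one idempotent. Reachability is preserved under extending paths, which gives
stability. With the convexity of `S` it yields that a path from a reachable vertex into `S` must
start in `S`; this is the content of both `convex` and `vanish`. -/
theorem isSupportFamily_reachableIdems {n : ℕ} {τ : Equiv.Perm Q.V}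
    (hQ : Q.IsStableTranslationQuiver n τ) (hdeg : ∀ t, n + 1 < t → Q.degree t = ⊥)
    (hacyclic : Q.IsAcyclic) {S : Set Q.V} (hS : Q.IsCompleteSlice τ S) [Finite (Q.slice S).V]
    {i : Q.V} (hi : i ∈ S) :
    IsSupportFamily (Q.cornerHom S) Q.unitDegree (n + 1) (Q.reachableIdems i) where
  nonempty := ⟨_, ∅, by simp, rfl⟩
  directed := by
    classical
    rintro _ ⟨F, hF, rfl⟩ _ ⟨G, hG, rfl⟩
    refine ⟨_, ⟨F ∪ G, fun j hj => ?_, rfl⟩, idemSum_mul_idemSum Finset.subset_union_left,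
      idemSum_mul_idemSum Finset.subset_union_right⟩
    exact (Finset.mem_union.1 hj).elim (hF j) (hG j)
  stable := by
    classical
    rintro u _ ⟨F, hF, rfl⟩
    suffices h : ∃ G : Finset Q.V, (∀ j ∈ G, Nonempty (Path i j)) ∧
        Q.idemSum G * (u * Q.idemSum F) = u * Q.idemSum F by
      obtain ⟨G, hG, h⟩ := h
      exact ⟨_, ⟨G, hG, rfl⟩, h⟩
    refine Q.unitization_induction u ?_ ?_ ?_ ?_
    · exact ⟨F, hF, by rw [one_mul, idemSum_mul_idemSum le_rfl]⟩
    · rintro x y ⟨G, hG, hx⟩ ⟨H, hH, hy⟩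
      refine ⟨G ∪ H, fun j hj => (Finset.mem_union.1 hj).elim (hG j) (hH j), ?_⟩
      rw [add_mul, mul_add, ← hx, ← hy, ← mul_assoc, ← mul_assoc (Q.idemSum (G ∪ H)),
        idemSum_mul_idemSum Finset.subset_union_left, idemSum_mul_idemSum Finset.subset_union_right]
    · rintro c x ⟨G, hG, hx⟩
      exact ⟨G, hG, by rw [smul_mul_assoc, mul_smul_comm, hx]⟩
    · intro a b p
      by_cases ha : a ∈ F
      · obtain ⟨r⟩ := hF a ha
        refine ⟨{b}, fun j hj => ?_, ?_⟩
        · rw [Finset.mem_singleton] at hj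
          subst hj
          exact ⟨r.comp p⟩
        · rw [cls_mul_idemSum p ha, idemSum_mul_cls p (Finset.mem_singleton_self b)]
      · exact ⟨∅, by simp, by rw [cls_mul_idemSum_of_notMem p ha, mul_zero]⟩
  degree_zero := by
    rintro _ ⟨F, hF, rfl⟩
    exact Submodule.sum_mem _ fun j _ =>
      inr_mem_unitDegree (Q.cls_mem_degree (Path.nil : Path j j))
  convex := by
    rintro u _ ⟨F, hF, rfl⟩
    refine Q.unitization_induction u ?_ ?_ ?_ ?_
    · rw [mul_one, ← mul_assoc, ← map_mul, one_mul]
    · intro x y hx hy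
      rw [mul_add, add_mul, add_mul, hx, hy]
    · intro c x hx
      rw [mul_smul_comm, smul_mul_assoc, smul_mul_assoc, hx]
    · intro a b p
      rw [cornerHom_apply, mul_assoc, mul_assoc, ← mul_assoc (Q.cls p : Unitization k Q.Alg),
        ← Unitization.inr_mul]
      by_cases ha : a ∈ S
      · rw [cls_mul_sliceIncl_one p ha]
      · rw [cls_mul_sliceIncl_one_of_notMem p ha, Unitization.inr_zero, zero_mul, mul_zero]
        by_cases haF : a ∈ F
        · obtain ⟨r⟩ := hF a haF
          -- Otherwise `a` would lie on a path from `i` to `b`, both in `S`.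
          have hb : b ∉ S := fun hb => ha (hS.convex i a b hi hb r p)
          rw [cls_mul_idemSum p haF, ← Unitization.inr_mul, sliceIncl_one_mul_cls_of_notMem p hb,
            Unitization.inr_zero]
        · rw [cls_mul_idemSum_of_notMem p haF, mul_zero]
  vanish := by
    rintro u hu _ ⟨F, hF, rfl⟩
    rw [unitDegree, if_neg (Nat.succ_ne_zero n), sup_bot_eq] at hu
    obtain ⟨x, hx, rfl⟩ := hu
    change Q.cornerHom S 1 * (x : Unitization k Q.Alg) * _ = 0
    induction hx using Submodule.span_induction with
    | zero => simp
    | add x y _ _ hx hy => rw [Unitization.inr_add, mul_add, add_mul, hx, hy, add_zero]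
    | smul c x _ hx => rw [Unitization.inr_smul, mul_smul_comm, smul_mul_assoc, hx, smul_zero]
    | mem x hx =>
      obtain ⟨a, b, p, hp, rfl⟩ := hx
      by_cases haF : a ∈ F
      swap
      · rw [mul_assoc, cls_mul_idemSum_of_notMem p haF, mul_zero]
      by_cases hb : b ∈ S
      · obtain ⟨r⟩ := hF a haF
        -- The source `a` lies between `i` and `b`, so `p` has both ends in the slice and is too
        -- long to be nonzero.
        rw [hS.cls_eq_zero hQ hdeg hacyclic p hp (hS.convex i a b hi hb r p) hb,
          Unitization.inr_zero, mul_zero, zero_mul]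
      · rw [cornerHom_apply, ← Unitization.inr_mul, sliceIncl_one_mul_cls_of_notMem p hb,
          Unitization.inr_zero, zero_mul]

theorem inr_mem_gradedRad {t : ℕ} (ht : 0 < t) {x : Q.Alg} (hx : x ∈ Q.degree t) :
    (x : Unitization k Q.Alg) ∈ gradedRad Q.unitDegree :=
  Submodule.subset_span ⟨t, ht, inr_mem_unitDegree hx⟩

variable (Q) in
/-- The left ideal defining the simple module at `i`. -/
noncomputable abbrev simpleIdeal (i : Q.V) : Ideal (Unitization k Q.Alg) :=
  Ideal.span {1 - (Q.idem i : Unitization k Q.Alg)} ⊔ gradedRad Q.unitDegree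

theorem sub_mul_idem_mem_simpleIdeal (i : Q.V) (u : Unitization k Q.Alg) :
    u - u * Q.idem i ∈ Q.simpleIdeal i := by
  have := (Q.simpleIdeal i).mul_mem_left u
    (Submodule.mem_sup_left (Ideal.mem_span_singleton_self _))
  rwa [mul_sub, mul_one] at this

theorem mul_idem_mem_simpleIdeal {i j : Q.V} (hij : i ≠ j) (u : Unitization k Q.Alg) :
    u * Q.idem j ∈ Q.simpleIdeal i := by
  refine (Q.simpleIdeal i).mul_mem_left u ?_
  have := sub_mul_idem_mem_simpleIdeal i (Q.idem j : Unitization k Q.Alg)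
  rwa [← Unitization.inr_mul, idem, idem, cls_mul_cls_ne _ _ _ hij.symm, Unitization.inr_zero,
    sub_zero] at this

/-- The generators only control right multiplication by `e_i`. Left multiplication agrees with it
modulo the ideal because the quotient sees just the trivial paths: longer paths are in the radical,
and the trivial paths at other vertices are in the ideal. -/
theorem idem_mul_sub_mem_simpleIdeal (i : Q.V) (u : Unitization k Q.Alg) :
    Q.idem i * u - u ∈ Q.simpleIdeal i := by
  refine Q.unitization_induction u ?_ ?_ ?_ ?_
  · have := neg_mem (sub_mul_idem_mem_simpleIdeal i (1 : Unitization k Q.Alg))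
    rwa [neg_sub, one_mul, ← mul_one (Q.idem i : Unitization k Q.Alg)] at this
  · intro x y hx hy
    have := add_mem hx hy
    rwa [sub_add_sub_comm, ← mul_add] at this
  · intro c x hx
    have := (Q.simpleIdeal i).mul_mem_left (algebraMap k _ c) hx
    rwa [← Algebra.smul_def, smul_sub, ← mul_smul_comm] at this
  · intro a b p
    by_cases hp : p.length = 0
    · obtain rfl := Path.eq_of_length_zero p hp
      obtain rfl := Path.eq_nil_of_length_zero p hp
      change _ * (Q.idem a : Unitization k Q.Alg) - Q.idem a ∈ _
      by_cases hia : i = a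
      · subst hia
        rw [← Unitization.inr_mul, idem, cls_mul_cls, Path.comp_nil, sub_self]
        exact zero_mem _
      · refine sub_mem (mul_idem_mem_simpleIdeal hia _) ?_
        have := mul_idem_mem_simpleIdeal hia (1 : Unitization k Q.Alg)
        rwa [one_mul] at this
    · have h := inr_mem_gradedRad (Nat.pos_of_ne_zero hp) (Q.cls_mem_degree p)
      exact Submodule.mem_sup_right (sub_mem (Ideal.mul_mem_left _ _ h) h)

theorem exists_reachableIdems_smul_simple (i : Q.V) :
    ∃ e ∈ Q.reachableIdems i, ∀ s : Q.Simple i, e • s = s := by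
  refine ⟨Q.idem i, ⟨{i}, fun j hj => ?_, by simp [idemSum]⟩, fun s => ?_⟩
  · rw [Finset.mem_singleton] at hj
    subst hj
    exact ⟨Path.nil⟩
  · obtain ⟨u, rfl⟩ := Submodule.Quotient.mk_surjective _ s
    rw [← Submodule.Quotient.mk_smul, Submodule.Quotient.eq]
    exact idem_mul_sub_mem_simpleIdeal i u

/-! ## The semisimple quotient of the slice algebra -/

/-- The trivial paths are orthogonal idempotents spanning degree zero, so this ring is a quotient of
the finite product of copies of `k` indexed by the vertices. -/
theorem isSemisimpleRing_degree_zero [Finite Q.V] : IsSemisimpleRing (Q.degree 0) := by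
  classical
  have := Fintype.ofFinite Q.V
  have hmem : ∀ i, Q.idem i ∈ Q.degree 0 := fun i => Q.cls_mem_degree (Path.nil : Path i i)
  have hmul : ∀ i j, Q.idem i * Q.idem j = if i = j then Q.idem i else 0 := by
    intro i j
    split_ifs with h
    · subst h
      exact idem_mul_cls _
    · exact Q.cls_mul_cls_ne _ _ h
  let f : (Q.V → k) →+* Q.degree 0 :=
    { toFun := fun c => ⟨∑ i, c i • Q.idem i,
        Submodule.sum_mem _ fun i _ => Submodule.smul_mem _ _ (hmem i)⟩
      map_one' := Subtype.ext (by
        rw [SetLike.GradeZero.coe_one, one_def]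
        simp)
      map_zero' := Subtype.ext (by simp)
      map_add' := fun c d => Subtype.ext (by
        change _ = ∑ i, c i • Q.idem i + ∑ i, d i • Q.idem i
        rw [← Finset.sum_add_distrib]
        exact Finset.sum_congr rfl fun i _ => add_smul _ _ _)
      map_mul' := fun c d => Subtype.ext (by
        rw [SetLike.GradeZero.coe_mul]
        change ∑ i, (c i * d i) • Q.idem i = (∑ i, c i • Q.idem i) * ∑ i, d i • Q.idem i
        rw [Finset.sum_mul_sum]
        refine Finset.sum_congr rfl fun i _ => ?_
        rw [Finset.sum_eq_single i]
        · rw [smul_mul_assoc, mul_smul_comm, hmul, if_pos rfl, mul_smul]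
        · intro j _ hj
          rw [smul_mul_assoc, mul_smul_comm, hmul, if_neg hj.symm, smul_zero, smul_zero]
        · simp) }
  refine RingHom.isSemisimpleRing_of_surjective f ?_
  rintro ⟨x, hx⟩
  suffices h : ∃ c : Q.V → k, ∑ i, c i • Q.idem i = x by
    obtain ⟨c, hc⟩ := h
    exact ⟨c, Subtype.ext hc⟩
  induction hx using Submodule.span_induction with
  | zero => exact ⟨0, by simp⟩
  | add x y _ _ hx hy =>
    obtain ⟨c, rfl⟩ := hx
    obtain ⟨d, rfl⟩ := hy
    exact ⟨c + d, by simp [add_smul, Finset.sum_add_distrib]⟩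
  | smul a x _ hx =>
    obtain ⟨c, rfl⟩ := hx
    exact ⟨a • c, by simp [mul_smul, Finset.smul_sum]⟩
  | mem x hx =>
    obtain ⟨i, j, p, hp, rfl⟩ := hx
    obtain rfl := Path.eq_of_length_zero p hp
    obtain rfl := Path.eq_nil_of_length_zero p hp
    refine ⟨Pi.single i 1, ?_⟩
    rw [Finset.sum_eq_single i]
    · rw [Pi.single_eq_same, one_smul]
      rfl
    · intro j _ hj
      rw [Pi.single_eq_of_ne hj, zero_smul]
    · simp

/-! ### The degree zero quotient of the slice algebra as a product of corners of simple modules -/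

section Decomposition

variable {S : Set Q.V} [Finite (Q.slice S).V]

theorem cornerHom_idem (i : (Q.slice S).V) :
    Q.cornerHom S ((Q.slice S).idem i) =
      (Q.idem ((Q.sliceHom S).obj i) : Unitization k Q.Alg) := by
  rw [cornerHom_apply, idem, sliceIncl_cls]
  rfl

theorem cornerProj_idem (hS : Q.IsConvex S) (i : (Q.slice S).V) :
    cornerProj hS (Q.idem ((Q.sliceHom S).obj i) : Unitization k Q.Alg) = (Q.slice S).idem i := by
  rw [← cornerHom_idem, cornerProj_cornerHom]

omit [Finite (Q.slice S).V] in
theorem sliceProj_cls_mapPath_mem_degree (hS : Q.IsConvex S) {i j : (Q.slice S).V} (p : Path i j) :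
    sliceProj hS (Q.cls ((Q.sliceHom S).mapPath p)) ∈
      (Q.slice S).degree ((Q.sliceHom S).mapPath p).length := by
  rw [← sliceIncl_cls, sliceProj_sliceIncl, length_sliceHom_mapPath]
  exact (Q.slice S).cls_mem_degree p

theorem cornerProj_inr_mem_degree (hS : Q.IsConvex S) {t : ℕ} {x : Q.Alg} (hx : x ∈ Q.degree t) :
    cornerProj hS (x : Unitization k Q.Alg) ∈ (Q.slice S).degree t := by
  rw [cornerProj_inr]
  have : Q.degree t ≤ ((Q.slice S).degree t).comap (sliceProj hS) := by
    conv_lhs => rw [degree]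
    rw [Submodule.span_le]
    rintro _ ⟨i, j, p, rfl, rfl⟩
    rw [SetLike.mem_coe, Submodule.mem_comap]
    by_cases h : i ∈ S ∧ j ∈ S
    · obtain ⟨p, rfl⟩ := hS.exists_mapPath p h.1 h.2
      exact sliceProj_cls_mapPath_mem_degree hS p
    · rw [sliceProj_cls_of_notMem hS p (by tauto)]
      exact zero_mem _
  exact this hx

variable (S) in
/-- The map from the slice algebra to the corner of a simple module. -/
noncomputable def toSimpleCorner (i : Q.V) :
    (Q.slice S).Alg →ₗ[(Q.slice S).Alg] corner (Q.cornerHom S) (Q.Simple i) False where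
  toFun a := ⟨Submodule.Quotient.mk (Q.cornerHom S a), by
    rw [← Submodule.Quotient.mk_smul, smul_eq_mul, ← map_mul, one_mul], False.elim⟩
  map_add' a b := Subtype.ext (congrArg Submodule.Quotient.mk (map_add (Q.cornerHom S) a b))
  map_smul' a b := Subtype.ext (congrArg Submodule.Quotient.mk (map_mul (Q.cornerHom S) a b))

theorem toSimpleCorner_eq_zero {i : Q.V} {a : (Q.slice S).Alg} :
    toSimpleCorner S i a = 0 ↔ Q.cornerHom S a ∈ Q.simpleIdeal i := by
  rw [← Submodule.Quotient.mk_eq_zero]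
  exact Subtype.ext_iff

/-- The degree zero part of the slice algebra is the product of the corners of the simple modules at
the vertices of the slice. -/
theorem nonempty_quotient_gradedRad_equiv (hS : Q.IsConvex S) :
    Nonempty (((Q.slice S).Alg ⧸ gradedRad (Q.slice S).degree) ≃ₗ[(Q.slice S).Alg]
      ∀ i : (Q.slice S).V, corner (Q.cornerHom S) (Q.Simple ((Q.sliceHom S).obj i)) False) := by
  classical
  have := Fintype.ofFinite (Q.slice S).V
  let f := LinearMap.pi fun i : (Q.slice S).V => toSimpleCorner S ((Q.sliceHom S).obj i)
  have hker : gradedRad (Q.slice S).degree = LinearMap.ker f := by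
    apply le_antisymm
    · rw [gradedRad, Ideal.span, Submodule.span_le]
      rintro a ⟨t, ht, ha⟩
      refine funext fun i => toSimpleCorner_eq_zero.2 (Submodule.mem_sup_right ?_)
      exact inr_mem_gradedRad ht (sliceIncl_mem_degree ha)
    · intro a ha
      -- For fixed `i`, the elements `u` with `φ u * e_i` in the radical form a left ideal, so it is
      -- enough to test the generators of the ideal of the simple module.
      have key : ∀ i : (Q.slice S).V, ∀ u ∈ Q.simpleIdeal ((Q.sliceHom S).obj i),
          cornerProj hS u * (Q.slice S).idem i ∈ gradedRad (Q.slice S).degree := by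
        intro i
        let I : Ideal (Unitization k Q.Alg) :=
          { carrier := {u | cornerProj hS u * (Q.slice S).idem i ∈ gradedRad (Q.slice S).degree}
            zero_mem' := by simp
            add_mem' := fun {x y} hx hy => by
              rw [Set.mem_ofPred_eq, map_add, add_mul]
              exact add_mem hx hy
            smul_mem' := fun c x hx => by
              rw [Set.mem_ofPred_eq, smul_eq_mul, map_mul, mul_assoc]
              exact Ideal.mul_mem_left _ _ hx }
        suffices h : Q.simpleIdeal ((Q.sliceHom S).obj i) ≤ I from h
        refine sup_le ?_ ?_
        · rw [Ideal.span_le, Set.singleton_subset_iff]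
          change cornerProj hS (1 - _) * _ ∈ gradedRad (Q.slice S).degree
          rw [map_sub, map_one, cornerProj_idem, sub_mul, one_mul, idem, cls_mul_cls, Path.comp_nil,
            sub_self]
          exact zero_mem _
        · rw [gradedRad, Ideal.span_le]
          rintro u ⟨t, ht, hu⟩
          rw [unitDegree, if_neg ht.ne', sup_bot_eq] at hu
          obtain ⟨x, hx, rfl⟩ := hu
          refine Submodule.subset_span ⟨t, ht, ?_⟩
          have := (Q.slice S).mul_mem_degree (cornerProj_inr_mem_degree hS hx)
            ((Q.slice S).cls_mem_degree (Path.nil : Path i i))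
          exact this
      -- Membership in the radical is checked on the summands `a * e_i`, one for each factor of the
      -- product.
      rw [← mul_one a, one_def, Finset.mul_sum]
      refine Submodule.sum_mem _ fun i _ => ?_
      have := key i _ (toSimpleCorner_eq_zero.1 (congrFun ha i))
      rwa [cornerProj_cornerHom] at this
  have hsurj : Function.Surjective f := by
    intro x
    choose z hz using fun i => Submodule.Quotient.mk_surjective _ (x i).1
    -- Right multiplication by `e_j` isolates one factor: at `i` the terms with `j ≠ i` lie in the
    -- ideal of the simple module, and the term `j = i` is congruent to `ψ 1 * z i`.
    refine ⟨∑ j, cornerProj hS (z j) * (Q.slice S).idem j, funext fun i => Subtype.ext ?_⟩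
    change Submodule.Quotient.mk (Q.cornerHom S _) = (x i).1
    rw [← (x i).2.1, ← hz i, ← Submodule.Quotient.mk_smul, Submodule.Quotient.eq, map_sum,
      ← Finset.add_sum_erase _ _ (Finset.mem_univ i), add_sub_right_comm]
    have hterm : ∀ j, Q.cornerHom S (cornerProj hS (z j) * (Q.slice S).idem j) =
        Q.cornerHom S 1 * z j * (Q.idem ((Q.sliceHom S).obj j) : Unitization k Q.Alg) := by
      intro j
      rw [map_mul, cornerHom_cornerProj, mul_assoc _ _ (Q.cornerHom S _), ← map_mul, one_mul,
        cornerHom_idem]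
    refine add_mem ?_ (Submodule.sum_mem _ fun j hj => ?_)
    · rw [hterm, ← neg_mem_iff, neg_sub]
      exact sub_mul_idem_mem_simpleIdeal _ _
    · rw [hterm]
      refine mul_idem_mem_simpleIdeal (fun h => ?_) _
      exact Finset.ne_of_mem_erase hj (Q.sliceHom_obj_injective S h).symm
  exact ⟨(Submodule.quotEquivOfEq _ _ hker).trans (f.quotKerEquivOfSurjective hsurj)⟩

end Decomposition

end BoundQuiver

/-- If `kQ / (ρ)` is an acyclic stable `n`-translation algebra with finitely many `τ`-orbits of
vertices and `S` is a complete `τ`-slice, then the `τ`-slice algebra defined by `S` (a unital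
algebra, since `S` is finite) is Koszul for the grading by path length. -/
theorem proposition6p5 {k : Type w} [Field k] (Q : BoundQuiver.{u, v, w} k) (n : ℕ)
    (τ : Equiv.Perm Q.V) (hQ : Q.IsStableTranslationAlgebra n τ) (hacyclic : Q.IsAcyclic)
    (hfin : Q.HasFinitelyManyOrbits τ) (S : Set Q.V) (hS : Q.IsCompleteSlice τ S) :
    haveI : Finite (Q.slice S).V := hS.finite hfin
    IsKoszul (Q.slice S).degree := by
  have : Finite (Q.slice S).V := hS.finite hfin
  obtain ⟨hQ, q, hdeg, hres⟩ := hQ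
  refine ⟨BoundQuiver.isSemisimpleRing_degree_zero, ?_⟩
  obtain ⟨e⟩ := BoundQuiver.nonempty_quotient_gradedRad_equiv (Q := Q) (S := S) hS.convex
  -- It remains to resolve the corner of the simple module at one vertex `i` of the slice; `φ` and
  -- `ψ` are `cornerProj` and `cornerHom`, with `p = n + 1` and the idempotents reachable from `i`
  -- as support family.
  refine HasLinearResolution.of_equiv e.symm (HasLinearResolution.pi.{u, w, max v w} fun i => ?_)
  exact HasAlmostLinearResolution.corner (φ := (BoundQuiver.cornerProj hS.convex).toRingHom)
    (BoundQuiver.isSupportFamily_reachableIdems hQ hdeg hacyclic hS (Q.sliceHom_obj_mem S i))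
    (BoundQuiver.cornerProj_cornerHom hS.convex) (BoundQuiver.cornerHom_cornerProj hS.convex)
    (fun t a ha => BoundQuiver.inr_mem_unitDegree (BoundQuiver.sliceIncl_mem_degree ha))
    (Q.slice S).one_mem_degree BoundQuiver.mem_iSup_unitDegree n.succ_pos
    (BoundQuiver.exists_reachableIdems_smul_simple _) (hres _)
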